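/- Let $F$ be R. Thompson's group, that is, the group (under composition) of all increasing piecewise linear self-homeomorphisms of $[0,1]$ with finitely many break points, all of them in $\mathbb{Z}[\frac12]$, and all slopes integer powers of $2$. For a finite set $U\subset(0,1)$ let $H_U=\{f\in F : f(u)=u \text{ for all } u\in U\}$. Then: 1. the derived subgroup $[F,F]$ is a simple group; 2. for every finite $U\subset(0,1)$ the derived subgroup $[H_U,H_U]$ is isomorphic to the direct product of $|U|+1$ copies of $[F,F]$; 3. if $U,V\subset(0,1)$ are finite and $|U|\neq|V|$, then the groups $H_U$ and $H_V$ are not isomorphic. -/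

import Mathlib

/-- `x` is a finite binary fraction, that is, an element of `ℤ[1/2]`. -/
def IsDyadic (x : ℝ) : Prop := ∃ (m : ℤ) (n : ℕ), x = m / 2 ^ n

/-- `f : [0,1] → [0,1]` is piecewise linear with finitely many break points, all of them
in `ℤ[1/2]`, and all slopes are powers of `2`: there is a finite set `S` of dyadic points such that
on every interval `[a,b]` whose interior misses `S` the map has the form `t ↦ 2 ^ k * t + d`. -/
def IsDyadicPL (f : unitInterval → unitInterval) : Prop :=
  ∃ S : Finset unitInterval, (∀ s ∈ S, IsDyadic (s : ℝ)) ∧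
    ∀ a b : unitInterval, a < b → (∀ s ∈ S, s ∉ Set.Ioo a b) →
      ∃ (k : ℤ) (d : ℝ), ∀ t ∈ Set.Icc a b, (f t : ℝ) = (2 : ℝ) ^ k * (t : ℝ) + d

theorem IsDyadic.add {x y : ℝ} (hx : IsDyadic x) (hy : IsDyadic y) : IsDyadic (x + y) := by
  obtain ⟨m, n, rfl⟩ := hx
  obtain ⟨p, q, rfl⟩ := hy
  refine ⟨m * 2 ^ q + p * 2 ^ n, n + q, ?_⟩
  push_cast
  field_simp
  ring

theorem IsDyadic.neg {x : ℝ} (hx : IsDyadic x) : IsDyadic (-x) := by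
  obtain ⟨m, n, rfl⟩ := hx
  exact ⟨-m, n, by push_cast; ring⟩

theorem IsDyadic.zpow_mul {x : ℝ} (hx : IsDyadic x) (k : ℤ) : IsDyadic ((2 : ℝ) ^ k * x) := by
  obtain ⟨m, n, rfl⟩ := hx
  rcases k with k | k
  · refine ⟨2 ^ k * m, n, ?_⟩
    push_cast
    simp only [Int.ofNat_eq_natCast, zpow_natCast]
    ring
  · refine ⟨m, n + (k + 1), ?_⟩
    rw [zpow_negSucc]
    field_simp
    ring

theorem IsDyadicPL.isDyadic_apply {f : unitInterval → unitInterval} (hf : IsDyadicPL f)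
    (h0 : f 0 = 0) (x : unitInterval) (hx : IsDyadic (x : ℝ)) : IsDyadic (f x : ℝ) := by
  classical
  obtain ⟨S, hS, hpl⟩ := hf
  have key : ∀ (a b : unitInterval), a < b → (∀ s ∈ S, s ∉ Set.Ioo a b) →
      IsDyadic (a : ℝ) → IsDyadic (b : ℝ) → IsDyadic (f a : ℝ) → IsDyadic (f b : ℝ) := by
    intro a b hab hs ha hb hfa
    obtain ⟨k, d, h⟩ := hpl a b hab hs
    have e : (f b : ℝ) = (f a : ℝ) + (2 : ℝ) ^ k * ((b : ℝ) + -(a : ℝ)) := by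
      rw [h a ⟨le_rfl, hab.le⟩, h b ⟨hab.le, le_rfl⟩]
      ring
    rw [e]
    exact hfa.add ((hb.add ha.neg).zpow_mul k)
  induction hn : (S.filter (fun s => s < x)).card using Nat.strong_induction_on generalizing x with
  | _ n ih =>
    have hz : IsDyadic ((0 : unitInterval) : ℝ) := ⟨0, 0, by simp⟩
    rcases (unitInterval.nonneg' (t := x)).eq_or_lt with h | hpos
    · rw [← h, h0]
      exact hz
    · rcases (S.filter (fun s => s < x)).eq_empty_or_nonempty with he | hne
      · refine key 0 x hpos ?_ hz hx (by rw [h0]; exact hz)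
        intro s hs hsx
        have : s ∈ S.filter (fun s => s < x) := Finset.mem_filter.2 ⟨hs, hsx.2⟩
        simp [he] at this
      · set m := (S.filter (fun s => s < x)).max' hne with hm
        have hmem := Finset.max'_mem _ hne
        rw [← hm, Finset.mem_filter] at hmem
        refine key m x hmem.2 ?_ (hS m hmem.1) hx (ih _ ?_ m (hS m hmem.1) rfl)
        · intro s hs hsx
          exact absurd (Finset.le_max' _ s (Finset.mem_filter.2 ⟨hs, hsx.2⟩))
            (not_le.2 hsx.1)
        · rw [← hn]
          apply Finset.card_lt_card
          refine ⟨fun s hs => ?_, fun hsub => ?_⟩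
          · rw [Finset.mem_filter] at hs ⊢
            exact ⟨hs.1, hs.2.trans hmem.2⟩
          · have := hsub (Finset.mem_filter.2 hmem)
            exact lt_irrefl _ (Finset.mem_filter.1 this).2

theorem homeo_zero_of_strictMono {g : unitInterval ≃ₜ unitInterval} (hg : StrictMono g) :
    g 0 = 0 := by
  have h : g 0 ≤ g (g.symm 0) := hg.monotone unitInterval.nonneg'
  rw [g.apply_symm_apply] at h
  exact le_antisymm h unitInterval.nonneg'

theorem homeo_symm_strictMono {g : unitInterval ≃ₜ unitInterval} (hg : StrictMono g) :
    StrictMono g.symm := by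
  intro a b hab
  rw [← hg.lt_iff_lt, g.apply_symm_apply, g.apply_symm_apply]
  exact hab

theorem IsDyadicPL.homeo_symm {g : unitInterval ≃ₜ unitInterval} (hg : StrictMono g)
    (h : IsDyadicPL g) : IsDyadicPL g.symm := by
  classical
  have hd := h.isDyadic_apply (homeo_zero_of_strictMono hg)
  have hm := homeo_symm_strictMono hg
  obtain ⟨S, hS, hpl⟩ := h
  refine ⟨S.image g, ?_, ?_⟩
  · intro s hs
    obtain ⟨r, hr, rfl⟩ := Finset.mem_image.1 hs
    exact hd r (hS r hr)
  · intro a b hab hs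
    obtain ⟨k, d, hk⟩ := hpl (g.symm a) (g.symm b) (hm hab) (by
      intro s hsS hsI
      refine hs (g s) (Finset.mem_image_of_mem _ hsS) ⟨?_, ?_⟩
      · simpa using hg hsI.1
      · simpa using hg hsI.2)
    refine ⟨-k, -((2 : ℝ) ^ (-k) * d), fun t ht => ?_⟩
    have e := hk (g.symm t) ⟨hm.monotone ht.1, hm.monotone ht.2⟩
    rw [g.apply_symm_apply] at e
    rw [e, zpow_neg]
    field_simp
    ring

theorem IsDyadicPL.homeo_comp {g f : unitInterval ≃ₜ unitInterval} (mf : StrictMono f)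
    (hg : IsDyadicPL g) (hf : IsDyadicPL f) : IsDyadicPL (fun t => g (f t)) := by
  classical
  have hd := (hf.homeo_symm mf).isDyadic_apply
    (homeo_zero_of_strictMono (homeo_symm_strictMono mf))
  obtain ⟨S, hS, hplS⟩ := hf
  obtain ⟨T, hT, hplT⟩ := hg
  refine ⟨S ∪ T.image f.symm, ?_, ?_⟩
  · intro s hs
    rcases Finset.mem_union.1 hs with hs | hs
    · exact hS s hs
    · obtain ⟨r, hr, rfl⟩ := Finset.mem_image.1 hs
      exact hd r (hT r hr)
  · intro a b hab hs
    obtain ⟨k, d, hk⟩ := hplS a b hab (fun s h => hs s (Finset.mem_union_left _ h))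
    obtain ⟨l, e, hl⟩ := hplT (f a) (f b) (mf hab) (by
      intro s hsT hsI
      refine hs (f.symm s) (Finset.mem_union_right _ (Finset.mem_image_of_mem _ hsT)) ⟨?_, ?_⟩
      · rw [← mf.lt_iff_lt, f.apply_symm_apply]
        exact hsI.1
      · rw [← mf.lt_iff_lt, f.apply_symm_apply]
        exact hsI.2)
    refine ⟨l + k, (2 : ℝ) ^ l * d + e, fun t ht => ?_⟩
    rw [hl (f t) ⟨mf.monotone ht.1, mf.monotone ht.2⟩, hk t ht,
      zpow_add₀ (two_ne_zero' ℝ)]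
    ring

/-- R. Thompson's group `F`: the increasing piecewise linear self-homeomorphisms of `[0,1]` with
all slopes powers of `2` and all break points in `ℤ[1/2]`, under composition. -/
def thompsonF : Subgroup (unitInterval ≃ₜ unitInterval) where
  carrier := {g | StrictMono g ∧ IsDyadicPL g}
  one_mem' := ⟨strictMono_id, ∅, by simp, fun _ _ _ _ => ⟨0, 0, fun t _ => by simp⟩⟩
  mul_mem' := fun hg hf => ⟨hg.1.comp hf.1, hg.2.homeo_comp hf.1 hf.2⟩
  inv_mem' := fun hg => ⟨homeo_symm_strictMono hg.1, hg.2.homeo_symm hg.1⟩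

/-- `H_U`: the subgroup of `F` consisting of the elements that fix every number in `U`. -/
def thompsonStabilizer (U : Set ℝ) : Subgroup thompsonF where
  carrier := {g | ∀ x : unitInterval, (x : ℝ) ∈ U → g.1 x = x}
  one_mem' := fun _ _ => rfl
  mul_mem' := by
    intro g f hg hf x hx
    change g.1 (f.1 x) = x
    rw [hf x hx, hg x hx]
  inv_mem' := by
    intro g hg x hx
    change g.1.symm x = x
    rw [Homeomorph.symm_apply_eq]
    exact (hg x hx).symm

namespace DyadicPL

open Filter Topology Set Equiv
open scoped commutatorElement

/-! Everything is reduced to one group, `compactPL`: the compactly supported dyadic piecewise linear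
bijections of the line. It is shown to be perfect and simple, and the derived subgroup of every
`H_U` is shown to be a power of it with `|U| + 1` factors; the case of empty `U` is `[F,F]`.

Extended by the identity, `H_U` becomes the group `fixingPL V` of dyadic piecewise linear bijections
fixing all points outside `V = (0,1) \ U`. At a common fixed point the one-sided germs are affine
and commute, so commutators are trivial near every point outside `V`, that is, they lie in
`germTrivialPL V`. Now `V` is a union of `|U| + 1` disjoint open intervals, and each is parametrized
by the line through a dyadic piecewise linear map (`exists_parametrization`). Its breaks may
accumulate at the ends, which therefore need not be dyadic. Conjugation turns triviality near the
ends into compact support, so `germTrivialPL V` is a power of `compactPL` (`germTrivialPL_equiv`).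
As that power is perfect and sits inside `fixingPL V`, it is the whole derived subgroup.

Perfectness: let `E` be the group of maps trivial near `-∞` and affine near `∞`, and `D = compactPL`
the kernel of the germ at `∞`. Conjugation by an element of `E` acts on a given element of `D` like
conjugation by some element of `D`, so `D / [D,D]` is central in `E / [D,D]`. Single breaks generate
`E`, and their conjugation relations together with this centrality already force `E / [D,D]` to
embed in the affine group (`injective_of_break_relations`). Hence `D = [D,D]`.

Simplicity: a nontrivial element of a normal subgroup displaces some interval `J`. Any two elements
of `compactPL` can be conjugated into `J`, where their commutator is a double commutator with the
given element. So the normal subgroup contains all commutators.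

Finally, a finite power of a nontrivial perfect simple group determines the number of factors
(`card_le_of_pi_mulEquiv`), which distinguishes `H_U` from `H_V`. -/

theorem isDyadic_zero : IsDyadic 0 := ⟨0, 0, by simp⟩

theorem isDyadic_one : IsDyadic 1 := ⟨1, 0, by simp⟩

theorem isDyadic_sub {x y : ℝ} (hx : IsDyadic x) (hy : IsDyadic y) : IsDyadic (x - y) := by
  simpa [sub_eq_add_neg] using hx.add hy.neg

theorem isDyadic_intCast (n : ℤ) : IsDyadic n := ⟨n, 0, by simp⟩

theorem isDyadic_two_zpow (k : ℤ) : IsDyadic (2 ^ k) := by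
  simpa using isDyadic_one.zpow_mul k

theorem two_zpow_pos (k : ℤ) : (0 : ℝ) < 2 ^ k := by positivity

theorem exists_isDyadic_between {a b : ℝ} (hab : a < b) : ∃ x, IsDyadic x ∧ x ∈ Ioo a b := by
  obtain ⟨n, hn⟩ := exists_pow_lt_of_lt_one (sub_pos.2 hab) (by norm_num : (1 / 2 : ℝ) < 1)
  have h2 : (0 : ℝ) < 2 ^ n := by positivity
  have hn' : 1 < (b - a) * 2 ^ n := by
    rw [one_div, inv_pow, inv_eq_one_div, div_lt_iff₀ h2] at hn
    exact hn
  refine ⟨(⌊a * 2 ^ n⌋ + 1 : ℤ) / 2 ^ n, ⟨_, n, rfl⟩, ?_, ?_⟩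
  · rw [lt_div_iff₀ h2]
    push_cast
    exact Int.lt_floor_add_one _
  · rw [div_lt_iff₀ h2]
    push_cast
    linarith [Int.floor_le (a * 2 ^ n)]

/-! ### Germs of dyadic affine maps -/

/-- Along the filter `l` the function `f` is affine, with slope a power of two and dyadic
constant term. -/
def AffineAlong (f : ℝ → ℝ) (l : Filter ℝ) : Prop :=
  ∃ (k : ℤ) (d : ℝ), IsDyadic d ∧ ∀ᶠ t in l, f t = 2 ^ k * t + d

theorem AffineAlong.mono {f : ℝ → ℝ} {l l' : Filter ℝ} (h : AffineAlong f l) (hl : l' ≤ l) :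
    AffineAlong f l' := by
  obtain ⟨k, d, hd, h⟩ := h
  exact ⟨k, d, hd, hl h⟩

theorem AffineAlong.congr {f g : ℝ → ℝ} {l : Filter ℝ} (h : AffineAlong f l) (hfg : f =ᶠ[l] g) :
    AffineAlong g l := by
  obtain ⟨k, d, hd, h⟩ := h
  refine ⟨k, d, hd, ?_⟩
  filter_upwards [h, hfg] with t h1 h2
  rw [← h2, h1]

theorem AffineAlong.comp {f g : ℝ → ℝ} {l l' : Filter ℝ} (hg : AffineAlong g l')
    (hf : AffineAlong f l) (hl : Tendsto f l l') : AffineAlong (fun t => g (f t)) l := by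
  obtain ⟨k, d, hd, h⟩ := hf
  obtain ⟨m, e, he, h'⟩ := hg
  refine ⟨m + k, 2 ^ m * d + e, (hd.zpow_mul m).add he, ?_⟩
  filter_upwards [h, hl.eventually h'] with t h1 h2
  rw [h2, h1, zpow_add₀ (two_ne_zero' ℝ)]
  ring

theorem affine_eq_of_two_points {k m : ℤ} {d e s t : ℝ} (hst : s ≠ t)
    (hs : (2 : ℝ) ^ k * s + d = 2 ^ m * s + e) (ht : (2 : ℝ) ^ k * t + d = 2 ^ m * t + e) :
    k = m ∧ d = e := by
  have h : ((2 : ℝ) ^ k - 2 ^ m) * (s - t) = 0 := by linear_combination hs - ht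
  have h2 : (2 : ℝ) ^ k = 2 ^ m := by
    rcases mul_eq_zero.1 h with h | h
    · linarith
    · exact absurd (sub_eq_zero.1 h) hst
  refine ⟨zpow_right_injective₀ (by norm_num) (by norm_num) h2, ?_⟩
  rw [h2] at hs
  linarith

theorem affine_germ_unique {f : ℝ → ℝ} {l : Filter ℝ} [l.NeBot] (hl : ∀ a, ∀ᶠ t in l, t ≠ a)
    {k m : ℤ} {d e : ℝ} (h : ∀ᶠ t in l, f t = 2 ^ k * t + d)
    (h' : ∀ᶠ t in l, f t = 2 ^ m * t + e) : k = m ∧ d = e := by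
  obtain ⟨s, hs, hs'⟩ := (h.and h').exists
  obtain ⟨t, ⟨ht, ht'⟩, hts⟩ := ((h.and h').and (hl s)).exists
  exact affine_eq_of_two_points hts (ht.symm.trans ht') (hs.symm.trans hs')

theorem eventually_ne_nhdsGT (x a : ℝ) : ∀ᶠ t in 𝓝[>] x, t ≠ a := by
  rcases eq_or_ne x a with rfl | h
  · filter_upwards [self_mem_nhdsWithin] with t ht
    exact ne_of_gt ht
  · exact nhdsWithin_le_nhds (eventually_ne_nhds h)

theorem eventually_ne_nhdsLT (x a : ℝ) : ∀ᶠ t in 𝓝[<] x, t ≠ a := by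
  rcases eq_or_ne x a with rfl | h
  · filter_upwards [self_mem_nhdsWithin] with t ht
    exact ne_of_lt ht
  · exact nhdsWithin_le_nhds (eventually_ne_nhds h)

theorem affine_germ_unique_right {f : ℝ → ℝ} {x : ℝ} {k m : ℤ} {d e : ℝ}
    (h : ∀ᶠ t in 𝓝[≥] x, f t = 2 ^ k * t + d) (h' : ∀ᶠ t in 𝓝[≥] x, f t = 2 ^ m * t + e) :
    k = m ∧ d = e :=
  affine_germ_unique (eventually_ne_nhdsGT x) (nhdsWithin_mono x Ioi_subset_Ici_self h)
    (nhdsWithin_mono x Ioi_subset_Ici_self h')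

theorem affine_germ_unique_left {f : ℝ → ℝ} {x : ℝ} {k m : ℤ} {d e : ℝ}
    (h : ∀ᶠ t in 𝓝[≤] x, f t = 2 ^ k * t + d) (h' : ∀ᶠ t in 𝓝[≤] x, f t = 2 ^ m * t + e) :
    k = m ∧ d = e :=
  affine_germ_unique (eventually_ne_nhdsLT x) (nhdsWithin_mono x Iio_subset_Iic_self h)
    (nhdsWithin_mono x Iio_subset_Iic_self h')

/-- The assignments `x ↦ [x, ∞)`, `x ↦ (-∞, x]` and `x ↦ ℝ`, treated uniformly. -/
def IsSide (s : ℝ → Set ℝ) : Prop :=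
  (∀ x, x ∈ s x) ∧ ∀ (k : ℤ) (d x : ℝ), MapsTo (fun t => (2 : ℝ) ^ k * t + d) (s x)
    (s (2 ^ k * x + d))

theorem isSide_Ici : IsSide Ici :=
  ⟨fun _ => self_mem_Ici, fun k d x t (ht : x ≤ t) => by
    have := mul_le_mul_of_nonneg_left ht (two_zpow_pos k).le
    simpa using this⟩

theorem isSide_Iic : IsSide Iic :=
  ⟨fun _ => self_mem_Iic, fun k d x t (ht : t ≤ x) => by
    have := mul_le_mul_of_nonneg_left ht (two_zpow_pos k).le
    simpa using this⟩

theorem isSide_univ : IsSide (fun _ => univ) := ⟨fun _ => mem_univ _, fun _ _ _ _ _ => mem_univ _⟩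

theorem IsSide.tendsto_affine {s : ℝ → Set ℝ} (hs : IsSide s) (k : ℤ) (d x : ℝ) :
    Tendsto (fun t => (2 : ℝ) ^ k * t + d) (𝓝[s x] x) (𝓝[s (2 ^ k * x + d)] (2 ^ k * x + d)) :=
  ContinuousWithinAt.tendsto_nhdsWithin (f := fun t : ℝ => (2 : ℝ) ^ k * t + d)
    (by fun_prop) (hs.2 k d x)

theorem IsSide.tendsto {s : ℝ → Set ℝ} (hs : IsSide s) {f : ℝ → ℝ} {x : ℝ}
    (hf : AffineAlong f (𝓝[s x] x)) : Tendsto f (𝓝[s x] x) (𝓝[s (f x)] (f x)) := by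
  obtain ⟨k, d, hd, h⟩ := hf
  rw [h.self_of_nhdsWithin (hs.1 x)]
  exact (hs.tendsto_affine k d x).congr' (h.mono fun t ht => ht.symm)

theorem IsSide.affineAlong_leftInverse {s : ℝ → Set ℝ} (hs : IsSide s) {f g : ℝ → ℝ} {x : ℝ}
    (hf : AffineAlong f (𝓝[s x] x)) (hg : ∀ᶠ t in 𝓝[s x] x, g (f t) = t) :
    AffineAlong g (𝓝[s (f x)] (f x)) := by
  obtain ⟨k, d, hd, h⟩ := hf
  have h2 : (2 : ℝ) ^ k ≠ 0 := (two_zpow_pos k).ne'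
  refine ⟨-k, 2 ^ (-k) * -d, hd.neg.zpow_mul _, ?_⟩
  have hx := h.self_of_nhdsWithin (hs.1 x)
  have ht := hs.tendsto_affine (-k) (2 ^ (-k) * -d) (f x)
  have hx' : (2 : ℝ) ^ (-k) * f x + 2 ^ (-k) * -d = x := by
    rw [hx, zpow_neg]
    field_simp
    ring
  rw [hx'] at ht
  filter_upwards [ht.eventually h, ht.eventually hg] with t h1 h3
  rw [h1] at h3
  rw [← h3]
  congr 1
  rw [zpow_neg]
  field_simp
  ring

/-- `f` is locally piecewise linear at `x`, with slopes powers of two, and with a break at `x` only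
if `x` is dyadic. -/
def DyadicPLAt (f : ℝ → ℝ) (x : ℝ) : Prop :=
  AffineAlong f (𝓝[≥] x) ∧ AffineAlong f (𝓝[≤] x) ∧ (¬ IsDyadic x → AffineAlong f (𝓝 x))

theorem DyadicPLAt.congr {f g : ℝ → ℝ} {x : ℝ} (h : DyadicPLAt f x) (hfg : f =ᶠ[𝓝 x] g) :
    DyadicPLAt g x :=
  ⟨h.1.congr (nhdsWithin_le_nhds hfg), h.2.1.congr (nhdsWithin_le_nhds hfg),
    fun hx => (h.2.2 hx).congr hfg⟩

theorem DyadicPLAt.of_affineAlong {f : ℝ → ℝ} {x : ℝ} (h : AffineAlong f (𝓝 x)) :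
    DyadicPLAt f x :=
  ⟨h.mono nhdsWithin_le_nhds, h.mono nhdsWithin_le_nhds, fun _ => h⟩

theorem DyadicPLAt.of_isDyadic {f : ℝ → ℝ} {x : ℝ} (hx : IsDyadic x)
    (h : AffineAlong f (𝓝[≥] x)) (h' : AffineAlong f (𝓝[≤] x)) : DyadicPLAt f x :=
  ⟨h, h', fun hn => absurd hx hn⟩

theorem dyadicPLAt_id (x : ℝ) : DyadicPLAt (fun t => t) x :=
  .of_affineAlong ⟨0, 0, isDyadic_zero, by simp⟩

/-- Since the constant term of the germ is dyadic, the germ and its inverse both preserve `ℤ[1/2]`.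
This keeps breaks dyadic under composition and inversion. -/
theorem DyadicPLAt.isDyadic_iff {f : ℝ → ℝ} {x : ℝ} (h : DyadicPLAt f x) :
    IsDyadic (f x) ↔ IsDyadic x := by
  obtain ⟨k, d, hd, h⟩ := h.1
  rw [h.self_of_nhdsWithin self_mem_Ici]
  constructor
  · intro hx
    have := (isDyadic_sub hx hd).zpow_mul (-k)
    rwa [add_sub_cancel_right, zpow_neg, inv_mul_cancel_left₀ (two_zpow_pos k).ne'] at this
  · exact fun hx => (hx.zpow_mul k).add hd

theorem DyadicPLAt.tendsto_right {f : ℝ → ℝ} {x : ℝ} (h : DyadicPLAt f x) :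
    Tendsto f (𝓝[≥] x) (𝓝[≥] (f x)) := isSide_Ici.tendsto h.1

theorem DyadicPLAt.tendsto_left {f : ℝ → ℝ} {x : ℝ} (h : DyadicPLAt f x) :
    Tendsto f (𝓝[≤] x) (𝓝[≤] (f x)) := isSide_Iic.tendsto h.2.1

theorem DyadicPLAt.continuousAt {f : ℝ → ℝ} {x : ℝ} (h : DyadicPLAt f x) : ContinuousAt f x :=
  continuousAt_iff_continuous_left_right.2
    ⟨h.tendsto_left.mono_right nhdsWithin_le_nhds, h.tendsto_right.mono_right nhdsWithin_le_nhds⟩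

theorem DyadicPLAt.comp {f g : ℝ → ℝ} {x : ℝ} (hg : DyadicPLAt g (f x)) (hf : DyadicPLAt f x) :
    DyadicPLAt (fun t => g (f t)) x :=
  ⟨hg.1.comp hf.1 hf.tendsto_right, hg.2.1.comp hf.2.1 hf.tendsto_left, fun hx =>
    (hg.2.2 (fun h => hx (hf.isDyadic_iff.1 h))).comp (hf.2.2 hx) hf.continuousAt⟩

theorem DyadicPLAt.leftInverse {f g : ℝ → ℝ} {x : ℝ} (hf : DyadicPLAt f x)
    (hg : ∀ᶠ t in 𝓝 x, g (f t) = t) : DyadicPLAt g (f x) := by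
  refine ⟨isSide_Ici.affineAlong_leftInverse hf.1 (nhdsWithin_le_nhds hg),
    isSide_Iic.affineAlong_leftInverse hf.2.1 (nhdsWithin_le_nhds hg), fun hx => ?_⟩
  have := isSide_univ.affineAlong_leftInverse (f := f) (g := g) (x := x)
    (by simpa using hf.2.2 (fun h => hx (hf.isDyadic_iff.2 h))) (by simpa using hg)
  simpa using this

/-! ### Dyadic piecewise linear bijections of the line and single breaks -/

/-- The group of dyadic piecewise linear increasing bijections of the line, with a locally finite
set of breaks. -/
def dyadicPL : Subgroup (Perm ℝ) where
  carrier := {f | ∀ x, DyadicPLAt f x}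
  one_mem' := dyadicPLAt_id
  mul_mem' := fun {f g} hf hg x => (hf (g x)).comp (hg x)
  inv_mem' := fun {f} hf x => by
    have := (hf (f.symm x)).leftInverse (g := f.symm) (by simp)
    rwa [f.apply_symm_apply] at this

theorem continuous_of_mem {f : Perm ℝ} (hf : f ∈ dyadicPL) : Continuous f :=
  continuous_iff_continuousAt.2 fun x => (hf x).continuousAt

/-- A continuous injection of the line is strictly monotone or strictly antitone; the positive slope
of the right germ at `0` excludes the latter. -/
theorem strictMono_of_mem {f : Perm ℝ} (hf : f ∈ dyadicPL) : StrictMono f := by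
  rcases (continuous_of_mem hf).strictMono_of_inj f.injective with h | h
  · exact h
  · obtain ⟨k, d, -, hk⟩ := (hf 0).1
    have h0 := hk.self_of_nhdsWithin self_mem_Ici
    obtain ⟨t, ht, ht0⟩ := ((hk.filter_mono (nhdsWithin_mono 0 Ioi_subset_Ici_self)).and
      (self_mem_nhdsWithin (s := Ioi (0 : ℝ)))).exists
    have := h ht0
    rw [ht, h0] at this
    have := mul_pos (two_zpow_pos k) ht0
    linarith

/-- The affine bijection `t ↦ 2 ^ k * t + d`. -/
noncomputable def affinePerm (k : ℤ) (d : ℝ) : Perm ℝ where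
  toFun t := 2 ^ k * t + d
  invFun t := 2 ^ (-k) * (t - d)
  left_inv t := by
    have := (two_zpow_pos k).ne'
    simp only [zpow_neg]
    field_simp
    ring
  right_inv t := by
    have := (two_zpow_pos k).ne'
    simp only [zpow_neg]
    field_simp
    ring

@[simp] theorem affinePerm_apply (k : ℤ) (d t : ℝ) : affinePerm k d t = 2 ^ k * t + d := rfl

theorem affinePerm_mem (k : ℤ) {d : ℝ} (hd : IsDyadic d) : affinePerm k d ∈ dyadicPL := fun _ =>
  .of_affineAlong ⟨k, d, hd, .of_forall fun _ => rfl⟩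

/-- Only the values have to match at `x`: a dyadic point may be a break, so the slopes are free. -/
theorem exists_glue {f g : Perm ℝ} (hf : f ∈ dyadicPL) (hg : g ∈ dyadicPL) {x : ℝ}
    (hx : IsDyadic x) (hfg : f x = g x) :
    ∃ h ∈ dyadicPL, (∀ t ≤ x, h t = f t) ∧ ∀ t, x ≤ t → h t = g t := by
  have mf := strictMono_of_mem hf
  have mg := strictMono_of_mem hg
  let F : ℝ → ℝ := fun t => if t ≤ x then f t else g t
  have F1 : ∀ t ≤ x, F t = f t := fun t ht => if_pos ht
  have F2 : ∀ t, x ≤ t → F t = g t := fun t ht => by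
    rcases ht.eq_or_lt with rfl | ht
    · rw [F1 _ le_rfl, hfg]
    · exact if_neg (not_le.2 ht)
  have mF : StrictMono F := by
    intro s t hst
    rcases le_total t x with h | h
    · rw [F1 _ h, F1 _ (hst.le.trans h)]
      exact mf hst
    · rcases le_total s x with h' | h'
      · rw [F1 _ h', F2 _ h]
        rcases h'.eq_or_lt with rfl | h''
        · rw [hfg]
          exact mg hst
        · calc f s < f x := mf h''
            _ = g x := hfg
            _ ≤ g t := mg.monotone h
      · rw [F2 _ h', F2 _ h]
        exact mg hst
  have sF : Function.Surjective F := by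
    intro y
    rcases le_total y (f x) with h | h
    · refine ⟨f.symm y, ?_⟩
      rw [F1, apply_symm_apply]
      rw [← mf.le_iff_le, apply_symm_apply]
      exact h
    · refine ⟨g.symm y, ?_⟩
      rw [F2, apply_symm_apply]
      rw [← mg.le_iff_le, apply_symm_apply, ← hfg]
      exact h
  refine ⟨Equiv.ofBijective F ⟨mF.injective, sF⟩, fun y => ?_, F1, F2⟩
  change DyadicPLAt F y
  rcases lt_trichotomy y x with h | rfl | h
  · refine (hf y).congr ?_
    filter_upwards [Iio_mem_nhds h] with t ht
    exact (F1 t (le_of_lt ht)).symm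
  · refine .of_isDyadic hx ((hg y).1.congr ?_) ((hf y).2.1.congr ?_)
    · filter_upwards [self_mem_nhdsWithin] with t ht
      exact (F2 t ht).symm
    · filter_upwards [self_mem_nhdsWithin] with t ht
      exact (F1 t ht).symm
  · refine (hg y).congr ?_
    filter_upwards [Ioi_mem_nhds h] with t ht
    exact (F2 t (le_of_lt ht)).symm

/-- The bijection with slope `1` before `y` and slope `2 ^ k` after `y`. -/
noncomputable def breakPerm (y : ℝ) (k : ℤ) : Perm ℝ where
  toFun t := if t ≤ y then t else y + 2 ^ k * (t - y)
  invFun t := if t ≤ y then t else y + 2 ^ (-k) * (t - y)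
  left_inv t := by
    have h2 := two_zpow_pos k
    dsimp only
    split_ifs with h h'
    · rfl
    · have := mul_pos h2 (sub_pos.2 (not_le.1 h))
      linarith
    · rw [zpow_neg]
      field_simp
      ring
  right_inv t := by
    have h2 := two_zpow_pos (-k)
    dsimp only
    split_ifs with h h'
    · rfl
    · have := mul_pos h2 (sub_pos.2 (not_le.1 h))
      linarith
    · rw [zpow_neg]
      have := two_zpow_pos k
      field_simp
      ring

theorem breakPerm_of_le {y t : ℝ} (k : ℤ) (h : t ≤ y) : breakPerm y k t = t := if_pos h

theorem breakPerm_of_ge {y t : ℝ} (k : ℤ) (h : y ≤ t) : breakPerm y k t = y + 2 ^ k * (t - y) := by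
  rcases h.eq_or_lt with rfl | h
  · rw [breakPerm_of_le _ le_rfl]
    ring
  · exact if_neg (not_le.2 h)

theorem breakPerm_mem {y : ℝ} (hy : IsDyadic y) (k : ℤ) : breakPerm y k ∈ dyadicPL := by
  obtain ⟨h, hh, h1, h2⟩ := exists_glue (f := 1) (g := affinePerm k (y - 2 ^ k * y)) (one_mem _)
    (affinePerm_mem k (isDyadic_sub hy (hy.zpow_mul k))) hy (by simp)
  have : h = breakPerm y k := by
    ext t
    rcases le_total t y with ht | ht
    · rw [h1 t ht, breakPerm_of_le k ht, Perm.one_apply]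
    · rw [h2 t ht, breakPerm_of_ge k ht, affinePerm_apply]
      ring
  exact this ▸ hh

theorem breakPerm_zero (y : ℝ) : breakPerm y 0 = 1 := by
  ext t
  rcases le_total t y with ht | ht
  · rw [breakPerm_of_le _ ht, Perm.one_apply]
  · rw [breakPerm_of_ge _ ht, Perm.one_apply]
    simp

theorem breakPerm_add (y : ℝ) (k m : ℤ) : breakPerm y (k + m) = breakPerm y k * breakPerm y m := by
  ext t
  rw [Perm.mul_apply]
  rcases le_total t y with ht | ht
  · rw [breakPerm_of_le _ ht, breakPerm_of_le _ ht, breakPerm_of_le _ ht]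
  · have := mul_nonneg (two_zpow_pos m).le (sub_nonneg.2 ht)
    rw [breakPerm_of_ge _ ht, breakPerm_of_ge _ ht, breakPerm_of_ge _ (by linarith),
      zpow_add₀ (two_ne_zero' ℝ)]
    ring

theorem breakPerm_eq_zpow (y : ℝ) (k : ℤ) : breakPerm y k = breakPerm y 1 ^ k := by
  have hadd := breakPerm_add y
  let φ : Multiplicative ℤ →* Perm ℝ :=
    ⟨⟨fun k => breakPerm y k.toAdd, breakPerm_zero y⟩, fun a b => hadd a.toAdd b.toAdd⟩
  have := map_zpow φ (Multiplicative.ofAdd 1) k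
  simpa [φ, ← ofAdd_zsmul] using this

/-- To the right of `y` the conjugating map is `t ↦ 2t - y`, which moves the break from `x` to `2x -
y` and keeps the slopes. To the left of `x` the conjugated map is trivial, so the break at `y`
cancels. -/
theorem breakPerm_conj {x y : ℝ} (h : y < x) :
    breakPerm y 1 * breakPerm x 1 * (breakPerm y 1)⁻¹ = breakPerm (2 * x - y) 1 := by
  rw [mul_inv_eq_iff_eq_mul]
  ext t
  simp only [Perm.mul_apply]
  rcases le_total t y with ht | ht
  · rw [breakPerm_of_le _ (ht.trans h.le), breakPerm_of_le _ ht, breakPerm_of_le _ (by linarith)]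
  · rcases le_total t x with ht' | ht'
    · rw [breakPerm_of_le _ ht', breakPerm_of_ge _ ht,
        breakPerm_of_le _ (by rw [zpow_one]; linarith)]
    · rw [breakPerm_of_ge _ ht', breakPerm_of_ge _ ht, zpow_one,
        breakPerm_of_ge _ (by linarith), breakPerm_of_ge _ (by linarith)]
      ring

/-- Two breaks with opposite exponents restore slope `1` and leave a translation whose length
depends on the distance between them. -/
theorem exists_shift_right {d y : ℝ} (hd : IsDyadic d) (hy : IsDyadic y) :
    ∃ m ∈ dyadicPL, (∀ t ≤ y - 2 * |d|, m t = t) ∧ ∀ t, y ≤ t → m t = t + d := by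
  rcases le_total 0 d with h | h
  · refine ⟨breakPerm (y - d) 1 * breakPerm y (-1), mul_mem (breakPerm_mem (isDyadic_sub hy hd) _)
      (breakPerm_mem hy _), fun t ht => ?_, fun t ht => ?_⟩
    · rw [abs_of_nonneg h] at ht
      rw [Perm.mul_apply, breakPerm_of_le (y := y) _ (by linarith), breakPerm_of_le _ (by linarith)]
    · rw [Perm.mul_apply, breakPerm_of_ge _ ht, breakPerm_of_ge _ (by norm_num; linarith)]
      norm_num
      ring
  · refine ⟨breakPerm (y + 2 * d) (-1) * breakPerm y 1, mul_mem (breakPerm_mem (hy.add (by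
      simpa using hd.zpow_mul 1)) _) (breakPerm_mem hy _), fun t ht => ?_, fun t ht => ?_⟩
    · rw [abs_of_nonpos h] at ht
      rw [Perm.mul_apply, breakPerm_of_le (y := y) _ (by linarith), breakPerm_of_le _ (by linarith)]
    · rw [Perm.mul_apply, breakPerm_of_ge _ ht, breakPerm_of_ge _ (by norm_num; linarith)]
      norm_num
      ring

theorem exists_shift_left {d y : ℝ} (hd : IsDyadic d) (hy : IsDyadic y) :
    ∃ m ∈ dyadicPL, (∀ t ≤ y, m t = t + d) ∧ ∃ z, ∀ t, z ≤ t → m t = t := by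
  have h2d : IsDyadic (2 * |d|) := by
    have : IsDyadic |d| := by
      rcases abs_choice d with h | h <;> rw [h]
      exacts [hd, hd.neg]
    simpa using this.zpow_mul 1
  obtain ⟨m, hm, h1, h2⟩ := exists_shift_right hd (hy.add h2d)
  refine ⟨affinePerm 0 d * m⁻¹, mul_mem (affinePerm_mem 0 hd) (inv_mem hm), fun t ht => ?_,
    y + 2 * |d| + d, fun t ht => ?_⟩
  · have : m⁻¹ t = t := by
      rw [Perm.inv_eq_iff_eq, h1 t (by linarith)]
    rw [Perm.mul_apply, this]
    simp
  · have : m⁻¹ t = t - d := by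
      rw [Perm.inv_eq_iff_eq, h2 _ (by linarith)]
      ring
    rw [Perm.mul_apply, this]
    simp

/-! ### Compactly supported maps and maps affine at infinity -/

/-- The compactly supported elements of `dyadicPL`. -/
def compactPL : Subgroup (Perm ℝ) where
  carrier := {f | f ∈ dyadicPL ∧ ∃ a b : ℝ, ∀ t, f t ≠ t → t ∈ Icc a b}
  one_mem' := ⟨one_mem _, 0, 0, fun t ht => absurd rfl ht⟩
  mul_mem' := by
    rintro f g ⟨hf, a, b, hab⟩ ⟨hg, a', b', hab'⟩
    refine ⟨mul_mem hf hg, min a a', max b b', fun t ht => ?_⟩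
    by_cases h : g t = t
    · have := hab t (by rwa [Perm.mul_apply, h] at ht)
      exact ⟨(min_le_left _ _).trans this.1, this.2.trans (le_max_left _ _)⟩
    · have := hab' t h
      exact ⟨(min_le_right _ _).trans this.1, this.2.trans (le_max_right _ _)⟩
  inv_mem' := by
    rintro f ⟨hf, a, b, hab⟩
    refine ⟨inv_mem hf, a, b, fun t ht => hab t fun h => ht ?_⟩
    rw [Perm.inv_eq_iff_eq, h]

/-- Beyond a dyadic interval `[p, q]` around `[a, b]` the map is replaced by one that starts as the
translation by `f p - p`, respectively `f q - q`, and dies out to the identity. -/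
theorem exists_compactPL_eqOn {f : Perm ℝ} (hf : f ∈ dyadicPL) (a b : ℝ) :
    ∃ g ∈ compactPL, ∀ t ∈ Icc a b, g t = f t := by
  obtain ⟨p, hp, hp'⟩ := exists_isDyadic_between (sub_one_lt (min a b))
  obtain ⟨q, hq, hq'⟩ := exists_isDyadic_between (lt_add_one (max a b))
  have hpq : p < q := hp'.2.trans (((min_le_left _ _).trans (le_max_left _ _)).trans_lt hq'.1)
  have hfp := isDyadic_sub ((hf p).isDyadic_iff.2 hp) hp
  have hfq := isDyadic_sub ((hf q).isDyadic_iff.2 hq) hq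
  obtain ⟨m, hm, hm1, hm2⟩ := exists_shift_right hfp hp
  obtain ⟨n, hn, hn1, z, hn2⟩ := exists_shift_left hfq hq
  obtain ⟨g, hg, hg1, hg2⟩ := exists_glue hm hf hp (by rw [hm2 p le_rfl]; ring)
  obtain ⟨h, hh, hh1, hh2⟩ := exists_glue hg hn hq (by rw [hg2 q hpq.le, hn1 q le_rfl]; ring)
  refine ⟨h, ⟨hh, min (p - 2 * |f p - p|) p, max z q, fun t ht => ⟨?_, ?_⟩⟩, fun t ht => ?_⟩
  · by_contra! h'
    have h1 := h'.trans_le (min_le_left _ _)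
    have h2 := h'.trans_le (min_le_right _ _)
    exact ht (by rw [hh1 t (by linarith), hg1 t h2.le, hm1 t h1.le])
  · by_contra! h'
    have h1 := (le_max_left _ _).trans_lt h'
    have h2 := (le_max_right _ _).trans_lt h'
    exact ht (by rw [hh2 t h2.le, hn2 t h1.le])
  · have h1 : p < t := hp'.2.trans_le ((min_le_left _ _).trans ht.1)
    have h2 : t < q := (ht.2.trans (le_max_right _ _)).trans_lt hq'.1
    rw [hh1 t h2.le, hg2 t h1.le]

/-- The elements of `dyadicPL` that are trivial near `-∞` and affine near `∞`. -/
def rightAffinePL : Subgroup (Perm ℝ) where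
  carrier := {f | f ∈ dyadicPL ∧ (∃ a : ℝ, ∀ t ≤ a, f t = t) ∧ AffineAlong f atTop}
  one_mem' := ⟨one_mem _, ⟨0, fun _ _ => rfl⟩, 0, 0, isDyadic_zero, by simp⟩
  mul_mem' := by
    rintro f g ⟨hf, ⟨a, ha⟩, hf'⟩ ⟨hg, ⟨b, hb⟩, hg'⟩
    refine ⟨mul_mem hf hg, ⟨min a b, fun t ht => ?_⟩, hf'.comp hg' ?_⟩
    · rw [Perm.mul_apply, hb t (ht.trans (min_le_right _ _)), ha t (ht.trans (min_le_left _ _))]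
    · exact (strictMono_of_mem hg).monotone.tendsto_atTop_atTop fun y => ⟨g⁻¹ y, by simp⟩
  inv_mem' := by
    rintro f ⟨hf, ⟨a, ha⟩, k, d, hd, h⟩
    refine ⟨inv_mem hf, ⟨a, fun t ht => ?_⟩, -k, 2 ^ (-k) * -d, hd.neg.zpow_mul _, ?_⟩
    · rw [Perm.inv_eq_iff_eq, ha t ht]
    · have ht : Tendsto (f⁻¹ : Perm ℝ) atTop atTop :=
        (strictMono_of_mem (inv_mem hf)).monotone.tendsto_atTop_atTop fun y => ⟨f y, by simp⟩
      filter_upwards [ht.eventually h] with t h1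
      rw [show f (f⁻¹ t) = t from f.apply_symm_apply t] at h1
      have := (two_zpow_pos k).ne'
      rw [zpow_neg]
      field_simp
      linarith

theorem compactPL_le_rightAffinePL : compactPL ≤ rightAffinePL := by
  rintro f ⟨hf, a, b, h⟩
  refine ⟨hf, ⟨a - 1, fun t ht => ?_⟩, 0, 0, isDyadic_zero, ?_⟩
  · by_contra h'
    linarith [(h t h').1]
  · filter_upwards [eventually_gt_atTop b] with t ht
    by_contra h'
    exact absurd (h t (by simpa using h')).2 (not_le.2 ht)

theorem breakPerm_mem_rightAffinePL {y : ℝ} (hy : IsDyadic y) (k : ℤ) :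
    breakPerm y k ∈ rightAffinePL := by
  refine ⟨breakPerm_mem hy k, ⟨y, fun t ht => breakPerm_of_le k ht⟩, k, y - 2 ^ k * y,
    isDyadic_sub hy (hy.zpow_mul k), ?_⟩
  filter_upwards [eventually_ge_atTop y] with t ht
  rw [breakPerm_of_ge k ht]
  ring

/-! ### Generation by single breaks -/

/-- A transitive relation that holds locally on both sides of each point holds globally. -/
theorem rel_of_local {R : ℝ → ℝ → Prop} (hR : ∀ x y z, x ≤ y → y ≤ z → R x y → R y z → R x z)
    (hr : ∀ x, ∀ᶠ y in 𝓝[≥] x, R x y) (hl : ∀ x, ∀ᶠ y in 𝓝[≤] x, R y x) {a b : ℝ} (hab : a ≤ b) :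
    R a b := by
  set S := {y | y ∈ Icc a b ∧ R a y} with hS
  have haS : a ∈ S := ⟨left_mem_Icc.2 hab, (hr a).self_of_nhdsWithin self_mem_Ici⟩
  have hbd : BddAbove S := ⟨b, fun y hy => hy.1.2⟩
  set c := sSup S with hc
  have hac : a ≤ c := le_csSup hbd haS
  have hcb : c ≤ b := csSup_le ⟨a, haS⟩ fun y hy => hy.1.2
  have hRc : R a c := by
    obtain ⟨ε, hε, h⟩ := (mem_nhdsLE_iff_exists_Ioc_subset' (sub_one_lt c)).1 (hl c)
    obtain ⟨y, hy, hy'⟩ := exists_lt_of_lt_csSup ⟨a, haS⟩ hε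
    have hyc : y ≤ c := le_csSup hbd hy
    exact hR a y c hy.1.1 hyc hy.2 (h ⟨hy', hyc⟩)
  rcases hcb.eq_or_lt with h | hlt
  · exact h ▸ hRc
  · obtain ⟨u, hu, h⟩ := (mem_nhdsGE_iff_exists_Ico_subset' (lt_add_one c)).1 (hr c)
    obtain ⟨y, hy, hy'⟩ := exists_between (lt_min hu hlt)
    have hyS : y ∈ S := ⟨⟨hac.trans hy.le, (hy'.trans_le (min_le_right _ _)).le⟩,
      hR a c y hac hy.le hRc (h ⟨hy.le, hy'.trans_le (min_le_left _ _)⟩)⟩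
    exact absurd (le_csSup hbd hyS) (not_le.2 hy)

/-- The group generated by the bijections with a single break, where the slope doubles. -/
noncomputable def breakGroup : Subgroup (Perm ℝ) :=
  Subgroup.closure {g | ∃ y, IsDyadic y ∧ g = breakPerm y 1}

theorem breakPerm_mem_breakGroup {y : ℝ} (hy : IsDyadic y) (k : ℤ) :
    breakPerm y k ∈ breakGroup := by
  rw [breakPerm_eq_zpow]
  have : breakPerm y 1 ∈ breakGroup := Subgroup.subset_closure ⟨y, hy, rfl⟩
  exact zpow_mem this k

theorem breakGroup_le : breakGroup ≤ dyadicPL :=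
  (Subgroup.closure_le _).2 fun _ ⟨_, hy, h⟩ => h ▸ breakPerm_mem hy 1

/-- One step of a sweep from left to right: precomposing `g` with a power of the break at `y`
changes only what happens after `y`, and corrects the slope there. -/
theorem exists_breakGroup_adjust {f g : Perm ℝ} (hf : f ∈ dyadicPL) (hg : g ∈ breakGroup) {y : ℝ}
    {k m : ℤ} {d e : ℝ} (hle : ∀ t ≤ y, g t = f t) (hge : ∀ t, y ≤ t → g t = 2 ^ k * t + d)
    (hfy : ∀ᶠ t in 𝓝[≥] y, f t = 2 ^ m * t + e) :
    ∃ h ∈ breakGroup, (∀ t ≤ y, h t = f t) ∧ ∀ t, y ≤ t → h t = 2 ^ m * t + e := by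
  have hy : (2 : ℝ) ^ k * y + d = 2 ^ m * y + e := by
    rw [← hge y le_rfl, hle y le_rfl]
    exact hfy.self_of_nhdsWithin self_mem_Ici
  rcases eq_or_ne k m with rfl | hkm
  · have : d = e := by linarith
    exact ⟨g, hg, hle, this ▸ hge⟩
  -- At a non-dyadic point `f` and `g` are both affine across `y`; as they agree on the left, their
  -- slopes on the right would agree too.
  have hdy : IsDyadic y := by
    by_contra hn
    obtain ⟨p, q, -, hpq⟩ := (hf y).2.2 hn
    obtain ⟨p', q', -, hpq'⟩ := (breakGroup_le hg y).2.2 hn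
    have hl : ∀ᶠ t in 𝓝[≤] y, g t = 2 ^ p * t + q := by
      filter_upwards [nhdsWithin_le_nhds hpq, self_mem_nhdsWithin] with t h1 h2
      rw [hle t h2, h1]
    have hr : ∀ᶠ t in 𝓝[≥] y, g t = 2 ^ k * t + d := by
      filter_upwards [self_mem_nhdsWithin] with t ht
      exact hge t ht
    have h1 := (affine_germ_unique_left hl (nhdsWithin_le_nhds hpq')).1
    have h2 := (affine_germ_unique_right hr (nhdsWithin_le_nhds hpq')).1
    have h3 := (affine_germ_unique_right hfy (nhdsWithin_le_nhds hpq)).1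
    exact hkm (by rw [h2, ← h1, h3])
  refine ⟨g * breakPerm y (m - k), mul_mem hg (breakPerm_mem_breakGroup hdy _), fun t ht => ?_,
    fun t ht => ?_⟩
  · rw [Perm.mul_apply, breakPerm_of_le _ ht, hle t ht]
  · have h2 := mul_nonneg (two_zpow_pos (m - k)).le (sub_nonneg.2 ht)
    rw [Perm.mul_apply, breakPerm_of_ge _ ht, hge _ (by linarith), zpow_sub₀ (two_ne_zero' ℝ)]
    have := (two_zpow_pos k).ne'
    field_simp
    linarith

/-- The identity agrees with `f` far to the left; sweeping right, the slope is corrected at each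
break. The implication `P y → P z` is transitive and holds locally, so `rel_of_local` replaces an
enumeration of the breaks. -/
theorem rightAffinePL_le_breakGroup : rightAffinePL ≤ breakGroup := by
  rintro f ⟨hf, ⟨a, ha⟩, m, e, -, h⟩
  obtain ⟨b, hb⟩ := eventually_atTop.1 h
  let P : ℝ → Prop := fun y => ∃ g ∈ breakGroup, (∀ t ≤ y, g t = f t) ∧
    ∃ (k : ℤ) (d : ℝ), ∀ t, y ≤ t → g t = 2 ^ k * t + d
  have step : ∀ (y z : ℝ) (k : ℤ) (d : ℝ), y ≤ z → (∀ t ∈ Icc y z, f t = 2 ^ k * t + d) →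
      P y → P z := by
    rintro y z k d hyz hk ⟨g, hg, h1, k', d', h2⟩
    rcases hyz.eq_or_lt with rfl | hyz
    · exact ⟨g, hg, h1, k', d', h2⟩
    obtain ⟨g', hg', h1', h2'⟩ := exists_breakGroup_adjust hf hg h1 h2
      (by filter_upwards [Icc_mem_nhdsGE hyz] with t ht using hk t ht)
    refine ⟨g', hg', fun t ht => ?_, k, d, fun t ht => h2' t (hyz.le.trans ht)⟩
    rcases le_total t y with h | h
    · exact h1' t h
    · rw [h2' t h, hk t ⟨h, ht⟩]
  have key : P (min a b) → P (max a b) := by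
    refine rel_of_local (R := fun y z => P y → P z) (fun x y z _ _ h h' hx => h' (h hx)) ?_ ?_
      min_le_max
    · intro x
      obtain ⟨k, d, -, hk⟩ := (hf x).1
      obtain ⟨u, hu, h⟩ := (mem_nhdsGE_iff_exists_Ico_subset' (lt_add_one x)).1 hk
      filter_upwards [Ico_mem_nhdsGE hu] with z hz
      exact step x z k d hz.1 fun t ht => h ⟨ht.1, ht.2.trans_lt hz.2⟩
    · intro x
      obtain ⟨k, d, -, hk⟩ := (hf x).2.1
      obtain ⟨u, hu, h⟩ := (mem_nhdsLE_iff_exists_Ioc_subset' (sub_one_lt x)).1 hk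
      filter_upwards [Ioc_mem_nhdsLE hu] with z hz
      exact step z x k d hz.2 fun t ht => h ⟨hz.1.trans_le ht.1, ht.2⟩
  obtain ⟨g, hg, h1, k, d, h2⟩ := key ⟨1, one_mem _,
    fun t ht => (ha t (ht.trans (min_le_left _ _))).symm, 0, 0, fun t _ => by simp⟩
  have hf' : ∀ t, max a b ≤ t → f t = 2 ^ m * t + e :=
    fun t ht => hb t ((le_max_right _ _).trans ht)
  -- A last correction matches the affine tail of `f` at infinity.
  obtain ⟨g', hg', h1', h2'⟩ := exists_breakGroup_adjust hf hg h1 h2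
    (by filter_upwards [self_mem_nhdsWithin] with t ht using hf' t ht)
  have : g' = f := by
    ext t
    rcases le_total t (max a b) with h | h
    · exact h1' t h
    · rw [h2' t h, hf' t h]
  exact this ▸ hg'

/-! ### Perfectness of the compactly supported group -/

/-- A group generated by elements `σ x` satisfying the conjugation relations of single breaks is
determined by the affine action, as soon as the kernel of the action is central. -/
theorem injective_of_break_relations {Q : Type*} [Group Q] (κ : Q →* Perm ℝ)
    (hκ : κ.ker ≤ Subgroup.center Q) (σ : ℝ → Q)
    (hσ : ∀ x, IsDyadic x → κ (σ x) = affinePerm 1 (-x))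
    (hconj : ∀ x y, IsDyadic x → IsDyadic y → y < x → σ y * σ x * (σ y)⁻¹ = σ (2 * x - y))
    (hgen : Subgroup.closure {q | ∃ x, IsDyadic x ∧ q = σ x} = ⊤) : Function.Injective κ := by
  have haff : ∀ x y, IsDyadic x → IsDyadic y → κ (σ x * (σ y)⁻¹) = affinePerm 0 (y - x) := by
    intro x y hx hy
    rw [map_mul, map_inv, hσ x hx, hσ y hy, mul_inv_eq_iff_eq_mul]
    ext t
    simp
    ring
  have hpow : ∀ (r : ℝ) (n : ℤ), affinePerm 0 r ^ n = affinePerm 0 (n * r) := by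
    intro r n
    have hadd : ∀ a b : ℝ, affinePerm 0 (a + b) = affinePerm 0 a * affinePerm 0 b := by
      intro a b
      ext t
      simp
      ring
    let φ : Multiplicative ℝ →* Perm ℝ :=
      ⟨⟨fun x => affinePerm 0 x.toAdd, by ext t; simp⟩, fun a b => hadd a.toAdd b.toAdd⟩
    have := map_zpow φ (Multiplicative.ofAdd r) n
    simpa [φ, ← ofAdd_zsmul] using this.symm
  have hcentral : ∀ p q : Q, κ p = κ q → ∃ a ∈ Subgroup.center Q, p = q * a := fun p q h =>
    ⟨q⁻¹ * p, hκ (by rw [MonoidHom.mem_ker, map_mul, map_inv, h, inv_mul_cancel]), by group⟩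
  -- Two dyadic translations are powers of a common one, so `p` and `q` are powers of a single lift
  -- `ρ` times central elements.
  have hcomm : ∀ (p q : Q) (a b : ℝ), IsDyadic a → IsDyadic b → κ p = affinePerm 0 a →
      κ q = affinePerm 0 b → p * q = q * p := by
    rintro p q _ _ ⟨m, i, rfl⟩ ⟨n, j, rfl⟩ hp hq
    have hr : IsDyadic (-(1 / 2 ^ (i + j))) := IsDyadic.neg ⟨1, i + j, by simp⟩
    set ρ := σ (-(1 / 2 ^ (i + j))) * (σ 0)⁻¹ with hρ
    have hκρ : κ ρ = affinePerm 0 (1 / 2 ^ (i + j)) := by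
      rw [hρ, haff _ _ hr isDyadic_zero]
      congr 1
      ring
    obtain ⟨a, ha, rfl⟩ := hcentral p (ρ ^ (m * 2 ^ j)) (by
      rw [hp, map_zpow, hκρ, hpow]
      congr 1
      push_cast
      field_simp
      ring)
    obtain ⟨b, hb, rfl⟩ := hcentral q (ρ ^ (n * 2 ^ i)) (by
      rw [hq, map_zpow, hκρ, hpow]
      congr 1
      push_cast
      field_simp
      ring)
    have ha' := fun g => (Subgroup.mem_center_iff.1 ha g)
    have hb' := fun g => (Subgroup.mem_center_iff.1 hb g)
    calc _ = ρ ^ (m * 2 ^ j) * (a * ρ ^ (n * 2 ^ i)) * b := by group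
      _ = ρ ^ (m * 2 ^ j) * ρ ^ (n * 2 ^ i) * (a * b) := by rw [← ha']; group
      _ = ρ ^ (n * 2 ^ i) * ρ ^ (m * 2 ^ j) * (b * a) := by rw [(Commute.refl ρ).zpow_zpow, hb']
      _ = ρ ^ (n * 2 ^ i) * (ρ ^ (m * 2 ^ j) * b) * a := by group
      _ = _ := by rw [hb']; group
  have hshift : ∀ x w c, IsDyadic x → IsDyadic w → IsDyadic c →
      σ x * (σ w)⁻¹ = σ (x + c) * (σ (w + c))⁻¹ := by
    intro x w c hx hw hc
    have half : ∀ {x}, IsDyadic x → IsDyadic (x / 2) := fun {x} h => by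
      have := h.zpow_mul (-1)
      rwa [zpow_neg_one, inv_mul_eq_div] at this
    -- `y` lies so far to the left that `hconj` applies to every conjugation below.
    obtain ⟨y, hy, hy'⟩ := exists_isDyadic_between
      (sub_one_lt (min (min x w) (min (x + 2 * c) (w + 2 * c))))
    have hlt := hy'.2
    simp only [lt_min_iff] at hlt
    obtain ⟨⟨hyx, hyw⟩, hyx', hyw'⟩ := hlt
    have hz := isDyadic_sub hy hc
    -- `e` lifts the translation by `c`. It carries `σ v` to `σ (v + c)`, because these are the
    -- conjugates of `σ ((v + y) / 2)` by `σ y` and by `σ (y - c)`. By `hcomm` it also commutes with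
    -- `σ x * (σ w)⁻¹`.
    set e := σ (y - c) * (σ y)⁻¹ with he
    have key : ∀ v, IsDyadic v → y < v → y < v + 2 * c → e * σ v * e⁻¹ = σ (v + c) := by
      intro v hv h1 h2
      have hv2 : IsDyadic ((v + y) / 2) := half (hv.add hy)
      have e1 : σ y * σ ((v + y) / 2) * (σ y)⁻¹ = σ v := by
        rw [hconj _ _ hv2 hy (by linarith)]
        congr 1
        ring
      have e2 : σ (y - c) * σ ((v + y) / 2) * (σ (y - c))⁻¹ = σ (v + c) := by
        rw [hconj _ _ hv2 hz (by linarith)]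
        congr 1
        ring
      rw [← e1, ← e2, he]
      group
    have h1 := hcomm e (σ x * (σ w)⁻¹) _ _ (isDyadic_sub hy hz) (isDyadic_sub hw hx)
      (haff _ _ hz hy) (haff _ _ hx hw)
    rw [← key x hx hyx hyx', ← key w hw hyw hyw', ← mul_inv_eq_iff_eq_mul.2 h1]
    group
  -- `u x` lifts the translation by `-x`; `hshift` makes `u` additive on dyadic numbers, and
  -- conjugation by `σ 0` doubles its argument.
  set u : ℝ → Q := fun x => σ x * (σ 0)⁻¹ with hu
  have hu0 : u 0 = 1 := mul_inv_cancel _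
  have huadd : ∀ x c, IsDyadic x → IsDyadic c → u (x + c) = u x * u c := by
    intro x c hx hc
    have := hshift x 0 c hx isDyadic_zero hc
    rw [zero_add] at this
    simp only [hu]
    rw [this]
    group
  have huneg : ∀ x, IsDyadic x → u (-x) = (u x)⁻¹ := by
    intro x hx
    rw [eq_inv_iff_mul_eq_one, ← huadd _ _ hx.neg hx, neg_add_cancel, hu0]
  have hσu : ∀ x, IsDyadic x → σ 0 * u x * (σ 0)⁻¹ = u (2 * x) := by
    have pos : ∀ x, IsDyadic x → 0 < x → σ 0 * u x * (σ 0)⁻¹ = u (2 * x) := by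
      intro x hx h
      have := hconj x 0 hx isDyadic_zero h
      rw [sub_zero] at this
      simp only [hu]
      rw [← this]
      group
    intro x hx
    rcases lt_trichotomy x 0 with h | rfl | h
    · have := pos (-x) hx.neg (by linarith)
      rw [mul_neg, huneg x hx, huneg (2 * x) (by simpa using hx.zpow_mul 1)] at this
      rw [← inv_inj, ← this]
      group
    · simp [hu0]
    · exact pos x hx h
  have hσu' : ∀ x, IsDyadic x → (σ 0)⁻¹ * u x * σ 0 = u (2⁻¹ * x) := by
    intro x hx
    have := hσu (2⁻¹ * x) (by simpa using hx.zpow_mul (-1))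
    rw [mul_inv_cancel_left₀ two_ne_zero] at this
    rw [← this]
    group
  -- A normal form as in `ℤ[1/2] ⋊ ℤ`; both `x` and `k` can be read off from the affine map `κ q`.
  have hform : ∀ q : Q, ∃ x, ∃ k : ℤ, IsDyadic x ∧ q = u x * σ 0 ^ k := by
    intro q
    have hq : q ∈ Subgroup.closure {q | ∃ x, IsDyadic x ∧ q = σ x} := hgen ▸ Subgroup.mem_top q
    induction hq using Subgroup.closure_induction_left with
    | one => exact ⟨0, 0, isDyadic_zero, by simp [hu0]⟩
    | mul_left p hp q _ ih =>
      obtain ⟨y, hy, rfl⟩ := hp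
      obtain ⟨x, k, hx, rfl⟩ := ih
      have h2x : IsDyadic (2 * x) := by simpa using hx.zpow_mul 1
      refine ⟨y + 2 * x, k + 1, hy.add h2x, ?_⟩
      rw [huadd _ _ hy h2x, ← hσu x hx, add_comm k, zpow_add]
      simp only [hu]
      group
    | inv_mul_cancel p hp q _ ih =>
      obtain ⟨y, hy, rfl⟩ := hp
      obtain ⟨x, k, hx, rfl⟩ := ih
      have hxy := isDyadic_sub hx hy
      refine ⟨2⁻¹ * (x - y), k - 1, by simpa using hxy.zpow_mul (-1), ?_⟩
      rw [← hσu' _ hxy, sub_eq_add_neg, add_comm x, huadd _ _ hy.neg hx, huneg y hy,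
        sub_eq_add_neg, add_comm k, zpow_add]
      simp only [hu]
      group
  rw [injective_iff_map_eq_one]
  intro q hq
  obtain ⟨x, k, hx, rfl⟩ := hform q
  have hk : κ (σ 0) ^ k = affinePerm k 0 := by
    have hadd : ∀ a b : ℤ, affinePerm (a + b) 0 = affinePerm a 0 * affinePerm b 0 := by
      intro a b
      ext t
      simp [zpow_add₀]
      ring
    let φ : Multiplicative ℤ →* Perm ℝ :=
      ⟨⟨fun x => affinePerm x.toAdd 0, by ext t; simp⟩, fun a b => hadd a.toAdd b.toAdd⟩
    have := map_zpow φ (Multiplicative.ofAdd 1) k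
    rw [hσ 0 isDyadic_zero, neg_zero]
    simpa [φ, ← ofAdd_zsmul] using this.symm
  rw [map_mul, map_zpow, hk, haff _ _ hx isDyadic_zero] at hq
  have h0 := congrArg (fun f : Perm ℝ => f 0) hq
  have h1 := congrArg (fun f : Perm ℝ => f 1) hq
  simp at h0 h1
  subst h0
  have : k = 0 := by
    simpa using zpow_right_injective₀ (by norm_num : (0 : ℝ) < 2) (by norm_num)
      (show (2 : ℝ) ^ k = 2 ^ (0 : ℤ) by simpa using h1)
  simp [this, hu0]

theorem conj_eq_of_eqOn_support {α : Type*} {f g h : Perm α} (hgh : ∀ x, f x ≠ x → g x = h x) :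
    g * f * g⁻¹ = h * f * h⁻¹ := by
  have key : ∀ {g h : Perm α}, (∀ x, f x ≠ x → g x = h x) → ∀ y, f (g⁻¹ y) ≠ g⁻¹ y →
      (g * f * g⁻¹) y = (h * f * h⁻¹) y := by
    intro g h hgh y hy
    have h1 : h⁻¹ y = g⁻¹ y := by
      rw [Perm.inv_eq_iff_eq, ← hgh _ hy]
      exact (g.apply_symm_apply y).symm
    simp only [Perm.mul_apply, h1]
    exact hgh _ fun h => hy (f.injective h)
  ext y
  by_cases hy : f (g⁻¹ y) = g⁻¹ y
  · by_cases hy' : f (h⁻¹ y) = h⁻¹ y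
    · simp only [Perm.mul_apply, hy, hy']
      exact (g.apply_symm_apply y).trans (h.apply_symm_apply y).symm
    · exact (key (fun x hx => (hgh x hx).symm) y hy').symm
  · exact key hgh y hy

/-- A conjugate of `f` depends only on the values of the conjugating map on the support of `f`,
which is bounded. -/
theorem exists_compactPL_conj {f e : Perm ℝ} (hf : f ∈ compactPL) (he : e ∈ dyadicPL) :
    ∃ g ∈ compactPL, e * f * e⁻¹ = g * f * g⁻¹ := by
  obtain ⟨-, a, b, hab⟩ := hf
  obtain ⟨g, hg, h⟩ := exists_compactPL_eqOn he a b
  exact ⟨g, hg, conj_eq_of_eqOn_support fun x hx => (h x (hab x hx)).symm⟩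

theorem conj_mem_compactPL {f e : Perm ℝ} (hf : f ∈ compactPL) (he : e ∈ dyadicPL) :
    e * f * e⁻¹ ∈ compactPL := by
  obtain ⟨g, hg, h⟩ := exists_compactPL_conj hf he
  rw [h]
  exact mul_mem (mul_mem hg hf) (inv_mem hg)

theorem affinePerm_mul (k m : ℤ) (d e : ℝ) :
    affinePerm k d * affinePerm m e = affinePerm (k + m) (2 ^ k * e + d) := by
  ext t
  simp [zpow_add₀]
  ring

/-- The affine germ at `∞`. -/
noncomputable def germAtTop : rightAffinePL →* Perm ℝ :=
  MonoidHom.mk' (fun f => affinePerm f.2.2.2.choose f.2.2.2.choose_spec.choose) fun f g => by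
    obtain ⟨-, hf⟩ := f.2.2.2.choose_spec.choose_spec
    obtain ⟨-, hg⟩ := g.2.2.2.choose_spec.choose_spec
    obtain ⟨-, hfg⟩ := (f * g).2.2.2.choose_spec.choose_spec
    have ht : Tendsto g.1 atTop atTop := (strictMono_of_mem g.2.1).monotone.tendsto_atTop_atTop
      fun y => ⟨g.1.symm y, by simp⟩
    have h := affine_germ_unique (l := atTop) (fun a => eventually_ne_atTop a) hfg
      (k := _) (m := f.2.2.2.choose + g.2.2.2.choose)
      (e := 2 ^ f.2.2.2.choose * g.2.2.2.choose_spec.choose + f.2.2.2.choose_spec.choose) (by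
        filter_upwards [hg, ht.eventually hf] with t h1 h2
        change f.1 (g.1 t) = _
        rw [h2, h1, zpow_add₀ (two_ne_zero' ℝ)]
        ring)
    rw [affinePerm_mul, ← h.1, ← h.2]

theorem germAtTop_eq {f : rightAffinePL} {k : ℤ} {d : ℝ}
    (h : ∀ᶠ t in atTop, f.1 t = 2 ^ k * t + d) : germAtTop f = affinePerm k d := by
  obtain ⟨-, hf⟩ := f.2.2.2.choose_spec.choose_spec
  have h := affine_germ_unique (l := atTop) (fun a => eventually_ne_atTop a) hf h
  exact congrArg₂ affinePerm h.1 h.2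

theorem mem_compactPL_of_germAtTop {f : rightAffinePL} (h : germAtTop f = 1) :
    f.1 ∈ compactPL := by
  obtain ⟨k, d, hd, hf⟩ := f.2.2.2
  obtain ⟨a, ha⟩ := f.2.2.1
  rw [germAtTop_eq hf] at h
  have hone : ∀ t, (2 : ℝ) ^ k * t + d = t := fun t => congrArg (fun f : Perm ℝ => f t) h
  obtain ⟨b, hb⟩ := eventually_atTop.1 hf
  refine ⟨f.2.1, a, b, fun t ht => ⟨?_, ?_⟩⟩
  · by_contra! h'
    exact ht (ha t h'.le)
  · by_contra! h'
    exact ht (by rw [hb t h'.le, hone])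

/-- The germ at `∞` factors through the quotient of `rightAffinePL` by `⁅D, D⁆`; injectivity of the
induced map says that its kernel `D` is no larger than `⁅D, D⁆`. -/
theorem compactPL_le_commutator : compactPL ≤ ⁅compactPL, compactPL⁆ := by
  set D : Subgroup rightAffinePL := compactPL.subgroupOf rightAffinePL with hD
  have hDn : D.Normal := ⟨fun f hf e => by
    rw [hD, Subgroup.mem_subgroupOf] at hf ⊢
    exact conj_mem_compactPL hf e.2.1⟩
  have hgerm : ∀ f ∈ D, germAtTop f = 1 := by
    intro f hf
    obtain ⟨-, a, b, h⟩ := Subgroup.mem_subgroupOf.1 hf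
    rw [germAtTop_eq (k := 0) (d := 0)]
    · ext t
      simp
    · filter_upwards [eventually_gt_atTop b] with t ht
      by_contra h'
      exact absurd (h t (by simpa using h')).2 (not_le.2 ht)
  have hDD : ⁅D, D⁆ ≤ D := Subgroup.commutator_le_left D D
  let κ : rightAffinePL ⧸ ⁅D, D⁆ →* Perm ℝ := QuotientGroup.lift ⁅D, D⁆ germAtTop
    fun f hf => hgerm f (hDD hf)
  let σ : ℝ → rightAffinePL ⧸ ⁅D, D⁆ := fun x =>
    open Classical in if h : IsDyadic x then
      QuotientGroup.mk ⟨breakPerm x 1, breakPerm_mem_rightAffinePL h 1⟩ else 1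
  have hσ : ∀ x (h : IsDyadic x),
      σ x = QuotientGroup.mk ⟨breakPerm x 1, breakPerm_mem_rightAffinePL h 1⟩ :=
    fun x h => dif_pos h
  have hinj : Function.Injective κ := by
    refine injective_of_break_relations κ ?_ σ ?_ ?_ ?_
    -- The kernel is central: `e * f * e⁻¹ * f⁻¹` equals a commutator `⁅g, f⁆` with `g` compactly
    -- supported.
    · intro q hq
      obtain ⟨f, rfl⟩ := QuotientGroup.mk_surjective q
      have hf : f.1 ∈ compactPL := mem_compactPL_of_germAtTop hq
      rw [Subgroup.mem_center_iff]
      intro p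
      obtain ⟨e, rfl⟩ := QuotientGroup.mk_surjective p
      obtain ⟨g, hg, h⟩ := exists_compactPL_conj hf e.2.1
      rw [← mul_inv_eq_iff_eq_mul, ← mul_inv_eq_one]
      change (QuotientGroup.mk (e * f * e⁻¹ * f⁻¹) : rightAffinePL ⧸ ⁅D, D⁆) = 1
      rw [QuotientGroup.eq_one_iff]
      have : e * f * e⁻¹ * f⁻¹ = ⁅(⟨g, compactPL_le_rightAffinePL hg⟩ : rightAffinePL), f⁆ := by
        apply Subtype.ext
        change e.1 * f.1 * e.1⁻¹ * f.1⁻¹ = g * f.1 * g⁻¹ * f.1⁻¹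
        rw [h]
      rw [this]
      exact Subgroup.commutator_mem_commutator (H₁ := D) (H₂ := D) (Subgroup.mem_subgroupOf.2 hg)
        (Subgroup.mem_subgroupOf.2 hf)
    · intro x hx
      rw [hσ x hx]
      refine germAtTop_eq ?_
      filter_upwards [eventually_ge_atTop x] with t ht
      rw [breakPerm_of_ge _ ht, zpow_one]
      ring
    · intro x y hx hy hyx
      rw [hσ x hx, hσ y hy, hσ _ (isDyadic_sub (by simpa using hx.zpow_mul 1) hy)]
      refine congrArg (QuotientGroup.mk (s := ⁅D, D⁆)) (Subtype.ext ?_)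
      exact breakPerm_conj hyx
    · rw [eq_top_iff]
      rintro q -
      obtain ⟨f, rfl⟩ := QuotientGroup.mk_surjective q
      have hf : f.1 ∈ breakGroup := rightAffinePL_le_breakGroup f.2
      have hbreak : ∀ z (hz : IsDyadic z),
          (QuotientGroup.mk (⟨breakPerm z 1, breakPerm_mem_rightAffinePL hz 1⟩ : rightAffinePL) :
            rightAffinePL ⧸ ⁅D, D⁆) ∈ Subgroup.closure {q | ∃ x, IsDyadic x ∧ q = σ x} :=
        fun z hz => Subgroup.subset_closure ⟨z, hz, (hσ z hz).symm⟩
      have key : ∀ g ∈ breakGroup, ∀ hg : g ∈ rightAffinePL,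
          (QuotientGroup.mk (⟨g, hg⟩ : rightAffinePL) : rightAffinePL ⧸ ⁅D, D⁆) ∈
            Subgroup.closure {q | ∃ x, IsDyadic x ∧ q = σ x} := by
        intro g hg
        induction hg using Subgroup.closure_induction_left with
        | one => exact fun _ => one_mem _
        | mul_left x hx y _ ih =>
          obtain ⟨z, hz, rfl⟩ := hx
          intro h
          have hz' := breakPerm_mem_rightAffinePL hz 1
          have hy : y ∈ rightAffinePL := (Subgroup.mul_mem_cancel_left _ hz').1 h
          exact mul_mem (hbreak z hz) (ih hy)
        | inv_mul_cancel x hx y _ ih =>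
          obtain ⟨z, hz, rfl⟩ := hx
          intro h
          have hz' := breakPerm_mem_rightAffinePL hz 1
          have hy : y ∈ rightAffinePL := (Subgroup.mul_mem_cancel_left _ (inv_mem hz')).1 h
          exact mul_mem (inv_mem (hbreak z hz)) (ih hy)
      exact key f.1 hf f.2
  intro f hf
  have hfE := compactPL_le_rightAffinePL hf
  have h1 : (QuotientGroup.mk (⟨f, hfE⟩ : rightAffinePL) : rightAffinePL ⧸ ⁅D, D⁆) = 1 := by
    refine hinj ?_
    rw [map_one]
    exact hgerm _ (Subgroup.mem_subgroupOf.2 hf)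
  rw [QuotientGroup.eq_one_iff] at h1
  have h2 := Subgroup.mem_map_of_mem rightAffinePL.subtype h1
  rw [Subgroup.map_commutator, hD, Subgroup.map_subgroupOf_eq_of_le compactPL_le_rightAffinePL]
    at h2
  exact h2

theorem commutator_compactPL : commutator compactPL = ⊤ := by
  rw [eq_top_iff]
  rintro f -
  have h : f.1 ∈ ⁅compactPL, compactPL⁆ := compactPL_le_commutator f.2
  rw [← Subgroup.map_subtype_commutator] at h
  obtain ⟨g, hg, hgf⟩ := h
  exact (Subtype.ext hgf : g = f) ▸ hg

theorem nontrivial_compactPL : Nontrivial compactPL := by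
  obtain ⟨g, hg, h⟩ := exists_compactPL_eqOn (affinePerm_mem 0 isDyadic_one) 0 0
  refine ⟨⟨⟨g, hg⟩, 1, fun h1 => ?_⟩⟩
  have h0 := h 0 (by simp)
  rw [show g = 1 from congrArg Subtype.val h1] at h0
  simp at h0

/-! ### Simplicity of the compactly supported group -/

theorem commute_of_disjoint_support {α : Type*} {f g : Perm α} (h : ∀ x, f x = x ∨ g x = x) :
    f * g = g * f :=
  Perm.Disjoint.commute h

/-- If `f` moves a set off itself, and `g`, `h` are supported in that set, then the commutator of
`g` and `h` is a double commutator with `f`. -/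
theorem commutator_eq_of_displaced {α : Type*} {f g h : Perm α} {J : Set α}
    (hJ : ∀ x ∈ J, f x ∉ J) (hg : ∀ x, g x ≠ x → x ∈ J) (hh : ∀ x, h x ≠ x → x ∈ J) :
    ⁅⁅g, f⁆, h⁆ = ⁅g, h⁆ := by
  -- `⁅g, f⁆ = g * k`, where `k` is supported in `f '' J`, disjoint from `J`; so `k` commutes with
  -- `h`.
  set k := f * g⁻¹ * f⁻¹ with hk
  have hkJ : ∀ x ∈ J, k x = x := by
    intro x hx
    have : g⁻¹ (f⁻¹ x) = f⁻¹ x := by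
      rw [Perm.inv_eq_iff_eq]
      by_contra hne
      refine hJ (f⁻¹ x) (hg _ (Ne.symm hne)) ?_
      rwa [show f (f⁻¹ x) = x from f.apply_symm_apply x]
    change f (g⁻¹ (f⁻¹ x)) = x
    rw [this]
    exact f.apply_symm_apply x
  have hkh : k * h = h * k := commute_of_disjoint_support fun x => by
    by_cases hx : h x = x
    · exact Or.inr hx
    · exact Or.inl (hkJ x (hh x hx))
  have e : ⁅g, f⁆ = g * k := by rw [commutatorElement_def, hk]; group
  calc ⁅⁅g, f⁆, h⁆ = g * (k * h) * k⁻¹ * g⁻¹ * h⁻¹ := by rw [e, commutatorElement_def]; group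
    _ = ⁅g, h⁆ := by rw [hkh, commutatorElement_def]; group

theorem isSimpleGroup_compactPL : IsSimpleGroup compactPL := by
  have := nontrivial_compactPL
  refine ⟨fun N hN => or_iff_not_imp_left.2 fun hne => ?_⟩
  obtain ⟨f, hf⟩ := Subgroup.ne_bot_iff_exists_ne_one.1 hne
  have hfN : f.1 ∈ N := f.2
  have hf1 : f.1 ≠ 1 := fun h => hf (Subtype.ext h)
  obtain ⟨x, hx⟩ : ∃ x, f.1.1 x ≠ x := by
    by_contra! h
    exact hf1 (Subtype.ext (Equiv.ext h))
  have hcont := continuous_of_mem f.1.2.1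
  obtain ⟨J, hJo, hxJ, hJ⟩ : ∃ J : Set ℝ, IsOpen J ∧ x ∈ J ∧ ∀ y ∈ J, f.1.1 y ∉ J := by
    obtain ⟨U, V, hU, hV, hxU, hxV, hUV⟩ := t2_separation hx
    exact ⟨V ∩ f.1.1 ⁻¹' U, hV.inter (hU.preimage hcont), ⟨hxV, hxU⟩,
      fun y hy hy' => disjoint_left.1 hUV hy.2 hy'.1⟩
  obtain ⟨c, d, hcd, hcdJ⟩ := mem_nhds_iff_exists_Ioo_subset.1 (hJo.mem_nhds hxJ)
  obtain ⟨p, hp, hpcd⟩ := exists_isDyadic_between (hcd.1.trans hcd.2)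
  rw [eq_top_iff, ← commutator_compactPL, commutator_def, Subgroup.commutator_le]
  rintro g - h -
  obtain ⟨-, a, b, hg⟩ := g.2
  obtain ⟨-, a', b', hh⟩ := h.2
  obtain ⟨M, hM0, hM⟩ : ∃ M : ℝ, 0 < M ∧ ∀ t ∈ Icc (min a a') (max b b'), |t| < M := by
    refine ⟨|min a a'| + |max b b'| + 1, by positivity, fun t ht => ?_⟩
    have h1 := neg_abs_le (min a a')
    have h2 := le_abs_self (max b b')
    have h3 := abs_nonneg (min a a')
    have h4 := abs_nonneg (max b b')
    rw [abs_lt]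
    exact ⟨by linarith [ht.1], by linarith [ht.2]⟩
  obtain ⟨ε, hε, hε1, hε2⟩ : ∃ ε : ℝ, 0 < ε ∧ ε ≤ p - c ∧ ε ≤ d - p :=
    ⟨min (p - c) (d - p), lt_min (sub_pos.2 hpcd.1) (sub_pos.2 hpcd.2), min_le_left _ _,
      min_le_right _ _⟩
  -- With `2 ^ k * M < ε` the contraction `t ↦ 2 ^ k * t + p` sends `(-M, M)`, which contains both
  -- supports, into `(c, d)`.
  obtain ⟨k, hk, -⟩ := exists_mem_Ioc_zpow (div_pos hε hM0) (one_lt_two (α := ℝ))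
  rw [lt_div_iff₀ hM0] at hk
  obtain ⟨w, hw, hwe⟩ := exists_compactPL_eqOn (affinePerm_mem k hp) (min a a') (max b b')
  have hwJ : ∀ t ∈ Icc (min a a') (max b b'), w t ∈ J := by
    intro t ht
    have hlt := abs_lt.1 (hM t ht)
    have hlt1 := mul_lt_mul_of_pos_left hlt.1 (two_zpow_pos k)
    have hlt2 := mul_lt_mul_of_pos_left hlt.2 (two_zpow_pos k)
    rw [hwe t ht, affinePerm_apply]
    exact hcdJ ⟨by linarith, by linarith⟩
  set W : compactPL := ⟨w, hw⟩ with hW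
  have hsupp : ∀ q : compactPL, (∀ t, q.1 t ≠ t → t ∈ Icc (min a a') (max b b')) →
      ∀ t, (W * q * W⁻¹).1 t ≠ t → t ∈ J := by
    intro q hq t ht
    have : q.1 (w⁻¹ t) ≠ w⁻¹ t := by
      intro h
      apply ht
      change w (q.1 (w⁻¹ t)) = t
      rw [h]
      exact w.apply_symm_apply t
    have := hwJ _ (hq _ this)
    rwa [show w (w⁻¹ t) = t from w.apply_symm_apply t] at this
  have hgJ := hsupp g fun t ht =>
    ⟨(min_le_left _ _).trans (hg t ht).1, (hg t ht).2.trans (le_max_left _ _)⟩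
  have hhJ := hsupp h fun t ht =>
    ⟨(min_le_right _ _).trans (hh t ht).1, (hh t ht).2.trans (le_max_right _ _)⟩
  have hcomm : ⁅⁅W * g * W⁻¹, f.1⁆, W * h * W⁻¹⁆ = ⁅W * g * W⁻¹, W * h * W⁻¹⁆ :=
    Subtype.ext (commutator_eq_of_displaced hJ hgJ hhJ)
  have hmem : ⁅⁅W * g * W⁻¹, f.1⁆, W * h * W⁻¹⁆ ∈ N := by
    have h1 : ∀ q n : compactPL, n ∈ N → ⁅q, n⁆ ∈ N := fun q n hn =>
      mul_mem (hN.conj_mem n hn q) (inv_mem hn)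
    have h2 : ∀ q n : compactPL, n ∈ N → ⁅n, q⁆ ∈ N := fun q n hn => by
      rw [← commutatorElement_inv]
      exact inv_mem (h1 q n hn)
    exact h2 _ _ (h1 _ _ hfN)
  rw [hcomm, ← conjugate_commutatorElement] at hmem
  have := hN.conj_mem _ hmem W⁻¹
  simpa [mul_assoc] using this

/-! ### Parametrizing open intervals by the line -/

/-- Each increment is the largest power of two strictly below the remaining gap, so the gap at least
halves at every step. -/
theorem exists_dyadic_sequence {p b : ℝ} (hp : IsDyadic p) (hpb : p < b) :
    ∃ c : ℕ → ℝ, c 0 = p ∧ (∀ n, ∃ j : ℤ, c (n + 1) = c n + 2 ^ j) ∧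
      (∀ n, IsDyadic (c n)) ∧ (∀ n, c n < b) ∧ ∀ x < b, ∃ n, x < c n := by
  have : ∀ r : ℝ, ∃ n : ℤ, 0 < r → r ∈ Ioc ((2 : ℝ) ^ n) (2 ^ (n + 1)) := fun r => by
    by_cases h : 0 < r
    · obtain ⟨n, hn⟩ := exists_mem_Ioc_zpow h (one_lt_two (α := ℝ))
      exact ⟨n, fun _ => hn⟩
    · exact ⟨0, fun h' => absurd h' h⟩
  choose J hJ using this
  let c : ℕ → ℝ := fun n => (fun x => x + 2 ^ J (b - x))^[n] p
  have hc : ∀ n, c (n + 1) = c n + 2 ^ J (b - c n) := fun n =>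
    Function.iterate_succ_apply' (fun x => x + (2 : ℝ) ^ J (b - x)) n p
  have hcb : ∀ n, c n < b := by
    intro n
    induction n with
    | zero => exact hpb
    | succ n ih =>
      have := (hJ (b - c n) (sub_pos.2 ih)).1
      rw [hc]
      linarith
  have hbd : ∀ n, b - c n ≤ (b - p) * (1 / 2) ^ n := by
    intro n
    induction n with
    | zero => simp [c]
    | succ n ih =>
      have := (hJ (b - c n) (sub_pos.2 (hcb n))).2
      rw [zpow_add_one₀ two_ne_zero] at this
      rw [hc, pow_succ]
      linarith
  refine ⟨c, rfl, fun n => ⟨_, hc n⟩, fun n => ?_, hcb, fun x hx => ?_⟩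
  · induction n with
    | zero => exact hp
    | succ n ih =>
      rw [hc]
      exact ih.add (isDyadic_two_zpow _)
  · obtain ⟨n, hn⟩ := exists_pow_lt_of_lt_one (div_pos (sub_pos.2 hx) (sub_pos.2 hpb))
      (by norm_num : (1 / 2 : ℝ) < 1)
    rw [lt_div_iff₀ (sub_pos.2 hpb)] at hn
    exact ⟨n, by linarith [hbd n]⟩

theorem exists_dyadic_bisequence {a b : ℝ} (hab : a < b) :
    ∃ c : ℤ → ℝ, (∀ n, ∃ j : ℤ, c (n + 1) = c n + 2 ^ j) ∧
      (∀ n, IsDyadic (c n)) ∧ (∀ n, c n ∈ Ioo a b) ∧ (∀ x < b, ∃ n, x < c n) ∧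
      ∀ x, a < x → ∃ n, c n < x := by
  obtain ⟨p, hp, hpa, hpb⟩ := exists_isDyadic_between hab
  obtain ⟨c, hc0, hcs, hcd, hcb, hcx⟩ := exists_dyadic_sequence hp hpb
  -- The half running down to `a` is the negative of a sequence running from `-p` up to `-a`.
  obtain ⟨c', hc0', hcs', hcd', hcb', hcx'⟩ := exists_dyadic_sequence hp.neg (neg_lt_neg hpa)
  have hmono : StrictMono c := strictMono_nat_of_lt_succ fun n => by
    obtain ⟨j, hj⟩ := hcs n
    linarith [two_zpow_pos j]
  have hmono' : StrictMono c' := strictMono_nat_of_lt_succ fun n => by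
    obtain ⟨j, hj⟩ := hcs' n
    linarith [two_zpow_pos j]
  let C : ℤ → ℝ := fun n => if 0 ≤ n then c n.toNat else -c' (-n).toNat
  have C1 : ∀ n : ℕ, C n = c n := fun n => by simp [C]
  have C2 : ∀ n : ℕ, C (-n) = -c' n := fun n => by
    rcases n.eq_zero_or_pos with rfl | hn
    · simp [C, hc0, hc0']
    · have : ¬ (0 : ℤ) ≤ -n := by omega
      simp only [C, if_neg this, neg_neg, Int.toNat_natCast]
  have hcases : ∀ n : ℤ, (∃ m : ℕ, n = m) ∨ ∃ m : ℕ, n = -(m + 1 : ℕ) := fun n => by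
    rcases n with m | m
    · exact Or.inl ⟨m, rfl⟩
    · exact Or.inr ⟨m, rfl⟩
  refine ⟨C, fun n => ?_, fun n => ?_, fun n => ?_, fun x hx => ?_, fun x hx => ?_⟩
  · rcases hcases n with ⟨m, rfl⟩ | ⟨m, rfl⟩
    · obtain ⟨j, hj⟩ := hcs m
      exact ⟨j, by rw [C1, ← hj, ← C1]; simp⟩
    · obtain ⟨j, hj⟩ := hcs' m
      refine ⟨j, ?_⟩
      rw [C2, hj, show (-(m + 1 : ℕ) + 1 : ℤ) = -m by push_cast; ring, C2]
      ring
  · rcases hcases n with ⟨m, rfl⟩ | ⟨m, rfl⟩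
    · rw [C1]
      exact hcd m
    · rw [C2]
      exact (hcd' _).neg
  · rcases hcases n with ⟨m, rfl⟩ | ⟨m, rfl⟩
    · rw [C1]
      have := hmono.monotone (Nat.zero_le m)
      exact ⟨by linarith, hcb m⟩
    · rw [C2]
      have := hmono'.monotone (Nat.zero_le (m + 1))
      exact ⟨by linarith [hcb' (m + 1)], by linarith⟩
  · obtain ⟨n, hn⟩ := hcx x hx
    exact ⟨n, by rwa [C1]⟩
  · obtain ⟨n, hn⟩ := hcx' (-x) (neg_lt_neg hx)
    exact ⟨-n, by rw [C2]; linarith⟩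

/-- Every open interval is parametrized by the line through a dyadic piecewise linear map. -/
theorem exists_parametrization {a b : ℝ} (hab : a < b) :
    ∃ φ : ℝ → ℝ, StrictMono φ ∧ (∀ x, DyadicPLAt φ x) ∧ range φ = Ioo a b := by
  obtain ⟨c, hcs, hcd, hcab, hcb, hca⟩ := exists_dyadic_bisequence hab
  choose j hj using hcs
  have hmono : StrictMono c := strictMono_int_of_lt_succ fun n => by
    rw [hj]
    linarith [two_zpow_pos (j n)]
  -- Linear interpolation of `c` between integers: the slopes `c (n + 1) - c n` are powers of two,
  -- and breaks occur only at integers.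
  let φ : ℝ → ℝ := fun t => c ⌊t⌋ + 2 ^ j ⌊t⌋ * (t - ⌊t⌋)
  have hφ : ∀ (n : ℤ) (t : ℝ), t ∈ Icc (n : ℝ) (n + 1) → φ t = c n + 2 ^ j n * (t - n) := by
    intro n t ht
    rcases ht.2.eq_or_lt with h | h
    · have : ⌊t⌋ = n + 1 := by
        rw [h]
        exact_mod_cast Int.floor_intCast (R := ℝ) (n + 1)
      have e : φ t = c ⌊t⌋ + 2 ^ j ⌊t⌋ * (t - ⌊t⌋) := rfl
      rw [e, this, hj, h]
      push_cast
      ring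
    · have : ⌊t⌋ = n := Int.floor_eq_iff.2 ⟨ht.1, h⟩
      simp only [φ, this]
  have hmem : ∀ t, φ t ∈ Ico (c ⌊t⌋) (c (⌊t⌋ + 1)) := by
    intro t
    have h1 := mul_nonneg (two_zpow_pos (j ⌊t⌋)).le (Int.fract_nonneg t)
    have h2 := mul_lt_mul_of_pos_left (Int.fract_lt_one t) (two_zpow_pos (j ⌊t⌋))
    rw [hj]
    simp only [φ, Int.self_sub_floor]
    exact ⟨by linarith, by linarith⟩
  have hφm : StrictMono φ := by
    intro s t hst
    rcases (Int.floor_mono hst.le).eq_or_lt with h | h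
    · simp only [φ, h]
      have := mul_lt_mul_of_pos_left hst (two_zpow_pos (j ⌊t⌋))
      linarith
    · exact (hmem s).2.trans_le ((hmono.monotone (Int.add_one_le_iff.2 h)).trans (hmem t).1)
  have hgerm : ∀ (n : ℤ) (l : Filter ℝ), Icc (n : ℝ) (n + 1) ∈ l → AffineAlong φ l := by
    intro n l hl
    refine ⟨j n, c n - 2 ^ j n * n, isDyadic_sub (hcd n) ((isDyadic_intCast n).zpow_mul _), ?_⟩
    filter_upwards [hl] with t ht
    rw [hφ n t ht]
    ring
  refine ⟨φ, hφm, fun x => ⟨?_, ?_, fun hx => ?_⟩, Subset.antisymm ?_ ?_⟩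
  · refine hgerm ⌊x⌋ _ ?_
    filter_upwards [Ico_mem_nhdsGE (Int.lt_floor_add_one x)] with t ht
    exact ⟨(Int.floor_le x).trans ht.1, ht.2.le⟩
  · refine hgerm (⌈x⌉ - 1) _ ?_
    have h : x - 1 < (⌈x⌉ - 1 : ℤ) + 1 := by
      push_cast
      linarith [Int.le_ceil x]
    have h1 : ((⌈x⌉ - 1 : ℤ) : ℝ) < x := by
      push_cast
      linarith [Int.ceil_lt_add_one x]
    filter_upwards [Ioc_mem_nhdsLE h1] with t ht
    refine ⟨ht.1.le, ht.2.trans ?_⟩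
    push_cast
    linarith [Int.le_ceil x]
  · refine hgerm ⌊x⌋ _ (Icc_mem_nhds ((Int.floor_le x).lt_of_ne fun h => hx ?_)
      (Int.lt_floor_add_one x))
    rw [← h]
    exact isDyadic_intCast _
  · rintro _ ⟨t, rfl⟩
    exact ⟨(hcab _).1.trans_le (hmem t).1, (hmem t).2.trans (hcab _).2⟩
  · intro x hx
    obtain ⟨N, hN⟩ := hcb x hx.2
    obtain ⟨M, hM⟩ := hca x hx.1
    obtain ⟨n, hn, hmax⟩ := Int.exists_greatest_of_bdd (P := fun n => c n ≤ x)
      ⟨N, fun z hz => (hmono.lt_iff_lt.1 (hz.trans_lt hN)).le⟩ ⟨M, hM.le⟩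
    have hn1 : x < c (n + 1) := by
      by_contra! h
      have := hmax _ h
      omega
    rw [hj] at hn1
    have h2 := two_zpow_pos (j n)
    refine ⟨n + (x - c n) / 2 ^ j n, ?_⟩
    rw [hφ n]
    · field_simp
      ring
    · have h0 := div_nonneg (sub_nonneg.2 hn) h2.le
      have h1 : (x - c n) / 2 ^ j n ≤ 1 := by
        rw [div_le_one h2]
        linarith
      exact ⟨by linarith, by linarith⟩

/-! ### Germ-trivial maps as powers of the compactly supported group -/

/-- The elements of `dyadicPL` that are trivial near every point outside `V`. -/
def germTrivialPL (V : Set ℝ) : Subgroup (Perm ℝ) where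
  carrier := {f | f ∈ dyadicPL ∧ ∀ x ∉ V, ∀ᶠ t in 𝓝 x, f t = t}
  one_mem' := ⟨one_mem _, fun _ _ => .of_forall fun _ => rfl⟩
  mul_mem' := by
    rintro f g ⟨hf, hf'⟩ ⟨hg, hg'⟩
    refine ⟨mul_mem hf hg, fun x hx => ?_⟩
    filter_upwards [hf' x hx, hg' x hx] with t h1 h2
    rw [Perm.mul_apply, h2, h1]
  inv_mem' := by
    rintro f ⟨hf, hf'⟩
    refine ⟨inv_mem hf, fun x hx => ?_⟩
    filter_upwards [hf' x hx] with t h1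
    rw [Perm.inv_eq_iff_eq, h1]

theorem exists_sigma_hom {ι : Type*} {φ : ι → ℝ → ℝ}
    (hφ : Function.Injective fun p : Σ _ : ι, ℝ => φ p.1 p.2) :
    ∃ Ψ : (ι → Perm ℝ) →* Perm ℝ, Function.Injective Ψ ∧
      (∀ g i t, Ψ g (φ i t) = φ i (g i t)) ∧ ∀ g x, (∀ i, x ∉ range (φ i)) → Ψ g x = x := by
  classical
  let e := Equiv.ofInjective _ hφ
  refine ⟨(Perm.extendDomainHom e).comp (Perm.sigmaCongrRightHom fun _ : ι => ℝ),
    (Perm.extendDomainHom_injective e).comp Perm.sigmaCongrRightHom_injective,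
    fun g i t => ?_, fun g x hx => ?_⟩
  · exact Perm.extendDomain_apply_image (Perm.sigmaCongrRight g) e ⟨i, t⟩
  · refine Perm.extendDomain_apply_not_subtype _ e ?_
    rintro ⟨⟨i, t⟩, rfl⟩
    exact hx i ⟨t, rfl⟩

/-- Conjugation by the parametrizations: being trivial near both ends of an interval is the same as
having compact support in its parameter. The hypotheses `ha` and `hb` put all end points outside the
union, where germs are trivial. -/
theorem germTrivialPL_equiv {ι : Type*} [Finite ι] {a b : ι → ℝ} (hab : ∀ i, a i < b i)
    (hdisj : Pairwise fun i j => Disjoint (Ioo (a i) (b i)) (Ioo (a j) (b j)))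
    (ha : ∀ i j, a i ∉ Ioo (a j) (b j)) (hb : ∀ i j, b i ∉ Ioo (a j) (b j)) :
    Nonempty ((ι → compactPL) ≃* germTrivialPL (⋃ i, Ioo (a i) (b i))) := by
  choose φ hφm hφd hφr using fun i => exists_parametrization (hab i)
  have hφmem : ∀ i t, φ i t ∈ Ioo (a i) (b i) := fun i t => hφr i ▸ mem_range_self t
  have hφinj : Function.Injective fun p : Σ _ : ι, ℝ => φ p.1 p.2 := by
    rintro ⟨i, s⟩ ⟨j, t⟩ h
    have hij : i = j := by
      by_contra hne
      refine disjoint_left.1 (hdisj hne) (hφmem i s) ?_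
      dsimp only at h
      rw [h]
      exact hφmem j t
    subst hij
    exact congrArg (Sigma.mk i) ((hφm i).injective h)
  obtain ⟨Ψ, hΨ, hΨφ, hΨn⟩ := exists_sigma_hom hφinj
  let ψ : ι → ℝ → ℝ := fun i => Function.invFun (φ i)
  have hψφ : ∀ i t, ψ i (φ i t) = t := fun i => Function.leftInverse_invFun (hφm i).injective
  have hψd : ∀ i t, DyadicPLAt (ψ i) (φ i t) := fun i t =>
    (hφd i t).leftInverse (.of_forall (hψφ i))
  let incl : (ι → compactPL) →* (ι → Perm ℝ) :=
    MonoidHom.pi fun i => compactPL.subtype.comp (Pi.evalMonoidHom _ i)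
  have hincl : Function.Injective incl := fun f g h =>
    funext fun i => Subtype.ext (congrFun h i)
  let Θ := Ψ.comp incl
  have hΘφ : ∀ g i t, Θ g (φ i t) = φ i ((g i).1 t) := fun g i t => hΨφ _ _ _
  have hrange : Θ.range = germTrivialPL (⋃ i, Ioo (a i) (b i)) := by
    apply le_antisymm
    · rintro _ ⟨g, rfl⟩
      have hout : ∀ x ∉ ⋃ i, Ioo (a i) (b i), ∀ᶠ t in 𝓝 x, Θ g t = t := by
        intro x hx
        choose A B hAB using fun i => (g i).2.2
        -- Finiteness of `ι` enters here: finitely many compact intervals that avoid `x` also avoid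
        -- a neighbourhood of `x`.
        have hev : ∀ᶠ t in 𝓝 x, ∀ i, t ∉ Icc (φ i (A i)) (φ i (B i)) := by
          refine eventually_all.2 fun i => isClosed_Icc.isOpen_compl.mem_nhds fun h => hx ?_
          exact mem_iUnion.2 ⟨i, (hφmem i _).1.trans_le h.1, h.2.trans_lt (hφmem i _).2⟩
        filter_upwards [hev] with t ht
        by_cases h : ∃ i s, φ i s = t
        · obtain ⟨i, s, rfl⟩ := h
          rw [hΘφ]
          congr 1
          by_contra hne
          have := hAB i s hne
          exact ht i ⟨(hφm i).monotone this.1, (hφm i).monotone this.2⟩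
        · push Not at h
          exact hΨn _ _ fun i ⟨s, hs⟩ => h i s hs
      refine ⟨fun x => ?_, hout⟩
      by_cases hx : x ∈ ⋃ i, Ioo (a i) (b i)
      · obtain ⟨i, hi⟩ := mem_iUnion.1 hx
        have hi' := hi
        rw [← hφr i] at hi'
        obtain ⟨t, rfl⟩ := hi'
        have h1 : DyadicPLAt (fun s => (g i).1 (ψ i s)) (φ i t) :=
          DyadicPLAt.comp ((g i).2.1 _) (hψd i t)
        refine (DyadicPLAt.comp (hφd i _) h1).congr ?_
        filter_upwards [isOpen_Ioo.mem_nhds hi] with s hs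
        rw [← hφr i] at hs
        obtain ⟨s, rfl⟩ := hs
        rw [hψφ, hΘφ]
      · refine (dyadicPLAt_id x).congr ?_
        filter_upwards [hout x hx] with t ht using ht.symm
    · rintro f ⟨hf, hfV⟩
      have hfm := strictMono_of_mem hf
      have hfa : ∀ i, ∀ᶠ t in 𝓝 (a i), f t = t := fun i =>
        hfV _ fun h => by
          obtain ⟨j, hj⟩ := mem_iUnion.1 h
          exact ha i j hj
      have hfb : ∀ i, ∀ᶠ t in 𝓝 (b i), f t = t := fun i =>
        hfV _ fun h => by
          obtain ⟨j, hj⟩ := mem_iUnion.1 h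
          exact hb i j hj
      have hmaps : ∀ h : Perm ℝ, StrictMono h → (∀ i, h (a i) = a i) → (∀ i, h (b i) = b i) →
          ∀ i t, ∃ s, φ i s = h (φ i t) := by
        intro h hm h1 h2 i t
        rw [← mem_range, hφr, ← h1, ← h2]
        exact ⟨by rw [h1]; exact h1 i ▸ hm (hφmem i t).1, by rw [h2]; exact h2 i ▸ hm (hφmem i t).2⟩
      choose G hG using hmaps f hfm (fun i => (hfa i).self_of_nhds) fun i => (hfb i).self_of_nhds
      choose G' hG' using hmaps f⁻¹ (strictMono_of_mem (inv_mem hf))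
        (fun i => by rw [Perm.inv_eq_iff_eq, (hfa i).self_of_nhds])
        (fun i => by rw [Perm.inv_eq_iff_eq, (hfb i).self_of_nhds])
      let P : ι → Perm ℝ := fun i => ⟨G i, G' i,
        fun t => (hφm i).injective (by rw [hG', hG]; exact f.symm_apply_apply _),
        fun t => (hφm i).injective (by rw [hG, hG']; exact f.apply_symm_apply _)⟩
      have hP : ∀ i, P i ∈ compactPL := by
        intro i
        refine ⟨fun x => ?_, ?_⟩
        · have h1 : DyadicPLAt (fun t => f (φ i t)) x := (hf _).comp (hφd i x)
          have h2 : DyadicPLAt (fun t => ψ i (f (φ i t))) x := by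
            refine DyadicPLAt.comp ?_ h1
            rw [← hG]
            exact hψd _ _
          refine h2.congr (.of_forall fun t => ?_)
          change ψ i (f (φ i t)) = G i t
          rw [← hG, hψφ]
        · obtain ⟨u, hu, hu'⟩ := (mem_nhdsGE_iff_exists_Ico_subset' (hab i)).1
            (mem_nhdsWithin_of_mem_nhds (hfa i))
          obtain ⟨v, hv, hv'⟩ := (mem_nhdsLE_iff_exists_Ioc_subset' (hab i)).1
            (mem_nhdsWithin_of_mem_nhds (hfb i))
          obtain ⟨y, hy, hy'⟩ := exists_between (lt_min hu (hab i))
          obtain ⟨z, hz, hz'⟩ := exists_between (max_lt hv (hab i))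
          obtain ⟨A, rfl⟩ : y ∈ range (φ i) := by
            rw [hφr]
            exact ⟨hy, hy'.trans_le (min_le_right _ _)⟩
          obtain ⟨B, rfl⟩ : z ∈ range (φ i) := by
            rw [hφr]
            exact ⟨(le_max_right _ _).trans_lt hz, hz'⟩
          refine ⟨A, B, fun t ht => ⟨?_, ?_⟩⟩
          · by_contra! h
            refine ht ((hφm i).injective ?_)
            change φ i (G i t) = _
            rw [hG]
            exact hu' ⟨(hφmem i t).1.le, (hφm i h).trans (hy'.trans_le (min_le_left _ _))⟩
          · by_contra! h
            refine ht ((hφm i).injective ?_)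
            change φ i (G i t) = _
            rw [hG]
            exact hv' ⟨((le_max_left _ _).trans_lt hz).trans (hφm i h), (hφmem i t).2.le⟩
      refine ⟨fun i => ⟨P i, hP i⟩, Equiv.ext fun x => ?_⟩
      by_cases hx : ∃ i s, φ i s = x
      · obtain ⟨i, s, rfl⟩ := hx
        rw [hΘφ]
        exact hG i s
      · push Not at hx
        have hx' : ∀ i, x ∉ range (φ i) := fun i ⟨s, hs⟩ => hx i s hs
        refine (hΨn _ _ hx').trans (hfV x fun h => ?_).self_of_nhds.symm
        obtain ⟨i, hi⟩ := mem_iUnion.1 h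
        exact hx' i (hφr i ▸ hi)
  exact ⟨(MonoidHom.ofInjective (f := Θ) (hΨ.comp hincl)).trans (MulEquiv.subgroupCongr hrange)⟩

/-! ### Commutators of maps with prescribed fixed points -/

/-- The elements of `dyadicPL` that fix every point outside `V`. -/
def fixingPL (V : Set ℝ) : Subgroup (Perm ℝ) where
  carrier := {f | f ∈ dyadicPL ∧ ∀ x ∉ V, f x = x}
  one_mem' := ⟨one_mem _, fun _ _ => rfl⟩
  mul_mem' := by
    rintro f g ⟨hf, hf'⟩ ⟨hg, hg'⟩
    refine ⟨mul_mem hf hg, fun x hx => ?_⟩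
    rw [Perm.mul_apply, hg' x hx, hf' x hx]
  inv_mem' := by
    rintro f ⟨hf, hf'⟩
    refine ⟨inv_mem hf, fun x hx => ?_⟩
    rw [Perm.inv_eq_iff_eq, hf' x hx]

theorem germTrivialPL_le_fixingPL (V : Set ℝ) : germTrivialPL V ≤ fixingPL V :=
  fun _ hf => ⟨hf.1, fun x hx => (hf.2 x hx).self_of_nhds⟩

/-- Affine germs at a common fixed point commute. -/
theorem IsSide.commute_germ {s : ℝ → Set ℝ} (hs : IsSide s) {f g : ℝ → ℝ} {x : ℝ}
    (hf : AffineAlong f (𝓝[s x] x)) (hg : AffineAlong g (𝓝[s x] x)) (hfx : f x = x)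
    (hgx : g x = x) : ∀ᶠ t in 𝓝[s x] x, f (g t) = g (f t) := by
  have tf := hs.tendsto hf
  have tg := hs.tendsto hg
  rw [hfx] at tf
  rw [hgx] at tg
  obtain ⟨k, d, -, hf⟩ := hf
  obtain ⟨m, e, -, hg⟩ := hg
  have hfx' := hf.self_of_nhdsWithin (hs.1 x)
  have hgx' := hg.self_of_nhdsWithin (hs.1 x)
  rw [hfx] at hfx'
  rw [hgx] at hgx'
  filter_upwards [hf, hg, tf.eventually hg, tg.eventually hf] with t h1 h2 h3 h4
  rw [h4, h3, h1, h2, show d = x - 2 ^ k * x by linarith, show e = x - 2 ^ m * x by linarith]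
  ring

/-- On each side of `x` both germs are homotheties centred at `x`, and these commute, whether or not
`x` is dyadic. -/
theorem commutator_germ_trivial {f g : Perm ℝ} (hf : f ∈ dyadicPL) (hg : g ∈ dyadicPL) {x : ℝ}
    (hfx : f x = x) (hgx : g x = x) : ∀ᶠ t in 𝓝 x, ⁅f, g⁆ t = t := by
  have hgf : ∀ᶠ t in 𝓝 x, f (g t) = g (f t) := by
    rw [← nhdsLE_sup_nhdsGE, eventually_sup]
    exact ⟨isSide_Iic.commute_germ (hf x).2.1 (hg x).2.1 hfx hgx,
      isSide_Ici.commute_germ (hf x).1 (hg x).1 hfx hgx⟩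
  have hx : ((g * f)⁻¹ : Perm ℝ) x = x := by
    rw [Perm.inv_eq_iff_eq, Perm.mul_apply, hfx, hgx]
  have ht : Tendsto ((g * f)⁻¹ : Perm ℝ) (𝓝 x) (𝓝 x) := by
    have := (continuous_of_mem (inv_mem (mul_mem hg hf))).tendsto x
    rwa [hx] at this
  filter_upwards [ht.eventually hgf] with t h
  have e : ⁅f, g⁆ = f * g * (g * f)⁻¹ := by
    rw [commutatorElement_def]
    group
  rw [e, Perm.mul_apply, Perm.mul_apply, h]
  exact (g * f).apply_symm_apply t

theorem commutator_fixingPL_le (V : Set ℝ) : ⁅fixingPL V, fixingPL V⁆ ≤ germTrivialPL V := by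
  rw [Subgroup.commutator_le]
  rintro f ⟨hf, hf'⟩ g ⟨hg, hg'⟩
  refine ⟨?_, fun x hx => commutator_germ_trivial hf hg (hf' x hx) (hg' x hx)⟩
  exact mul_mem (mul_mem (mul_mem hf hg) (inv_mem hf)) (inv_mem hg)

theorem map_commutator_eq {G H : Type*} [Group G] [Group H] (j : G →* H) :
    (commutator G).map j = ⁅j.range, j.range⁆ := by
  rw [commutator_def, Subgroup.map_commutator, MonoidHom.range_eq_map]

theorem commutator_eq_top_of_mulEquiv {G H : Type*} [Group G] [Group H] (e : G ≃* H)
    (h : commutator G = ⊤) : commutator H = ⊤ := by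
  have := map_commutator_eq e.toMonoidHom
  rw [h, ← MonoidHom.range_eq_map, MonoidHom.range_eq_top.2 e.surjective] at this
  exact this.symm

theorem commutator_pi_eq_top {ι : Type*} [Finite ι] {G : Type*} [Group G]
    (h : commutator G = ⊤) : commutator (ι → G) = ⊤ := by
  have := Subgroup.commutator_pi_pi_of_finite (fun _ : ι => (⊤ : Subgroup G)) fun _ => ⊤
  rw [commutator_def] at h
  rw [commutator_def]
  simpa [Subgroup.pi_top, h] using this

theorem commutator_le_of_perfect {G : Type*} [Group G] {H : Subgroup G}
    (h : commutator H = ⊤) : H = ⁅H, H⁆ := by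
  have := map_commutator_eq H.subtype
  rwa [h, ← MonoidHom.range_eq_map, Subgroup.range_subtype] at this

/-! ### Passing between `F` and the line -/

theorem dyadicPLAt_of_finite {F : ℝ → ℝ} (S : Finset ℝ) (hS : ∀ s ∈ S, IsDyadic s)
    (hF : ∀ p q, p < q → (∀ s ∈ S, s ∉ Ioo p q) →
      ∃ (k : ℤ) (d : ℝ), IsDyadic d ∧ ∀ t ∈ Icc p q, F t = 2 ^ k * t + d) (x : ℝ) :
    DyadicPLAt F x := by
  classical
  have key : ∀ T : Finset ℝ, x ∉ T → ∃ p q, x ∈ Ioo p q ∧ ∀ s ∈ T, s ∉ Ioo p q := by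
    intro T hT
    obtain ⟨p, q, hx, hpq⟩ := mem_nhds_iff_exists_Ioo_subset.1
      (T.finite_toSet.isClosed.isOpen_compl.mem_nhds (by simpa using hT : x ∈ (T : Set ℝ)ᶜ))
    exact ⟨p, q, hx, fun s hs h => hpq h hs⟩
  obtain ⟨p, q, hx, hpq⟩ := key (S.erase x) (by simp)
  have hpq' : ∀ s ∈ S, s ≠ x → s ∉ Ioo p q := fun s hs hsx => hpq s (Finset.mem_erase.2 ⟨hsx, hs⟩)
  refine ⟨?_, ?_, fun hn => ?_⟩
  · obtain ⟨k, d, hd, h⟩ := hF x q hx.2 fun s hs h =>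
      hpq' s hs h.1.ne' ⟨hx.1.trans h.1, h.2⟩
    refine ⟨k, d, hd, ?_⟩
    filter_upwards [Icc_mem_nhdsGE hx.2] with t ht using h t ht
  · obtain ⟨k, d, hd, h⟩ := hF p x hx.1 fun s hs h =>
      hpq' s hs h.2.ne ⟨h.1, h.2.trans hx.2⟩
    refine ⟨k, d, hd, ?_⟩
    filter_upwards [Icc_mem_nhdsLE hx.1] with t ht using h t ht
  · obtain ⟨p, q, hx, hpq⟩ := key S fun h => hn (hS x h)
    obtain ⟨k, d, hd, h⟩ := hF p q (hx.1.trans hx.2) hpq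
    refine ⟨k, d, hd, ?_⟩
    filter_upwards [Icc_mem_nhds hx.1 hx.2] with t ht using h t ht

/-- Having finitely many breaks is local and passes to adjacent intervals, so `rel_of_local` plays
the role of compactness. -/
theorem exists_finite_breaks {f : ℝ → ℝ} (hf : ∀ x, DyadicPLAt f x) {x y : ℝ} (hxy : x ≤ y) :
    ∃ S : Finset ℝ, (∀ s ∈ S, IsDyadic s) ∧ ∀ a b, x ≤ a → a < b → b ≤ y →
      (∀ s ∈ S, s ∉ Ioo a b) → ∃ (k : ℤ) (d : ℝ), ∀ t ∈ Icc a b, f t = 2 ^ k * t + d := by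
  classical
  refine rel_of_local (R := fun x y => ∃ S : Finset ℝ, (∀ s ∈ S, IsDyadic s) ∧ ∀ a b, x ≤ a →
      a < b → b ≤ y → (∀ s ∈ S, s ∉ Ioo a b) →
      ∃ (k : ℤ) (d : ℝ), ∀ t ∈ Icc a b, f t = 2 ^ k * t + d) ?_ ?_ ?_ hxy
  · rintro x y z - - ⟨S, hS, hSf⟩ ⟨T, hT, hTf⟩
    -- The junction `y` may be listed as a break only if it is dyadic; otherwise the two-sided germ
    -- at `y` forces the two affine pieces to coincide.
    refine ⟨S ∪ T ∪ if IsDyadic y then {y} else ∅, fun s hs => ?_, fun a b ha hab hb h => ?_⟩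
    · rw [Finset.mem_union, Finset.mem_union] at hs
      rcases hs with (hs | hs) | hs
      · exact hS s hs
      · exact hT s hs
      · split_ifs at hs with hy
        · rwa [Finset.mem_singleton.1 hs]
        · simp at hs
    · have h1 : ∀ s ∈ S, s ∉ Ioo a b := fun s hs =>
        h s (Finset.mem_union_left _ (Finset.mem_union_left _ hs))
      have h2 : ∀ s ∈ T, s ∉ Ioo a b := fun s hs =>
        h s (Finset.mem_union_left _ (Finset.mem_union_right _ hs))
      rcases le_or_gt b y with hby | hby
      · exact hSf a b ha hab hby h1
      rcases le_or_gt y a with hay | hay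
      · exact hTf a b hay hab hb h2
      have hy : ¬ IsDyadic y := fun hy =>
        h y (Finset.mem_union_right _ (by simp [hy])) ⟨hay, hby⟩
      obtain ⟨p, q, -, hpq⟩ := (hf y).2.2 hy
      obtain ⟨k, d, hk⟩ := hSf a y ha hay le_rfl fun s hs h => h1 s hs ⟨h.1, h.2.trans hby⟩
      obtain ⟨m, e, hm⟩ := hTf y b le_rfl hby hb fun s hs h => h2 s hs ⟨hay.trans h.1, h.2⟩
      obtain ⟨rfl, rfl⟩ := affine_germ_unique_left (f := f) (x := y) (k := k) (d := d)
        (by filter_upwards [Icc_mem_nhdsLE hay] with t ht using hk t ht)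
        (nhdsWithin_le_nhds hpq)
      obtain ⟨rfl, rfl⟩ := affine_germ_unique_right (f := f) (x := y) (k := m) (d := e)
        (by filter_upwards [Icc_mem_nhdsGE hby] with t ht using hm t ht)
        (nhdsWithin_le_nhds hpq)
      refine ⟨m, e, fun t ht => ?_⟩
      rcases le_total t y with hty | hty
      · exact hk t ⟨ht.1, hty⟩
      · exact hm t ⟨hty, ht.2⟩
  · intro x
    obtain ⟨k, d, -, hk⟩ := (hf x).1
    obtain ⟨u, hu, h⟩ := (mem_nhdsGE_iff_exists_Ico_subset' (lt_add_one x)).1 hk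
    filter_upwards [Ico_mem_nhdsGE hu] with z hz
    exact ⟨∅, by simp, fun a b ha _ hb _ => ⟨k, d, fun t ht =>
      h ⟨ha.trans ht.1, (ht.2.trans hb).trans_lt hz.2⟩⟩⟩
  · intro x
    obtain ⟨k, d, -, hk⟩ := (hf x).2.1
    obtain ⟨u, hu, h⟩ := (mem_nhdsLE_iff_exists_Ioc_subset' (sub_one_lt x)).1 hk
    filter_upwards [Ioc_mem_nhdsLE hu] with z hz
    exact ⟨∅, by simp, fun a b ha _ hb _ => ⟨k, d, fun t ht =>
      h ⟨hz.1.trans_le (ha.trans ht.1), ht.2.trans hb⟩⟩⟩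

open Classical in
/-- Extension of elements of `F` to the line by the identity. -/
noncomputable def extendF : thompsonF →* Perm ℝ :=
  (Perm.ofSubtype (p := (· ∈ unitInterval))).comp
    (MonoidHom.mk' (fun f : thompsonF => f.1.toEquiv) fun _ _ => rfl)

theorem extendF_injective : Function.Injective extendF := by
  classical
  intro f g h
  have := Perm.ofSubtype_injective h
  exact Subtype.ext (Homeomorph.toEquiv_injective this)

theorem extendF_coe (f : thompsonF) (x : unitInterval) : extendF f x = f.1 x := by
  classical
  exact Perm.ofSubtype_apply_coe _ x

theorem extendF_of_notMem (f : thompsonF) {x : ℝ} (hx : x ∉ unitInterval) : extendF f x = x := by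
  classical
  exact Perm.ofSubtype_apply_of_not_mem _ hx

theorem extendF_of_le {f : thompsonF} {x : ℝ} (hx : x ≤ 0) : extendF f x = x := by
  rcases hx.eq_or_lt with rfl | h
  · have := extendF_coe f 0
    rw [homeo_zero_of_strictMono f.2.1] at this
    exact this
  · exact extendF_of_notMem f fun h' => absurd h'.1 (not_le.2 h)

theorem extendF_of_ge {f : thompsonF} {x : ℝ} (hx : 1 ≤ x) : extendF f x = x := by
  rcases hx.eq_or_lt with rfl | h
  · have h1 : f.1 1 = 1 := by
      have : f.1 (f.1.symm 1) ≤ f.1 1 := f.2.1.monotone unitInterval.le_one'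
      rw [f.1.apply_symm_apply] at this
      exact le_antisymm unitInterval.le_one' this
    have := extendF_coe f 1
    rw [h1] at this
    exact this
  · exact extendF_of_notMem f fun h' => absurd h'.2 (not_le.2 h)

theorem extendF_mem_dyadicPL (f : thompsonF) : extendF f ∈ dyadicPL := by
  classical
  obtain ⟨S, hS, hpl⟩ := f.2.2
  have hd := f.2.2.isDyadic_apply (homeo_zero_of_strictMono f.2.1)
  refine dyadicPLAt_of_finite (insert 0 (insert 1 (S.image Subtype.val))) ?_ ?_
  · intro s hs
    simp only [Finset.mem_insert, Finset.mem_image] at hs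
    rcases hs with rfl | rfl | ⟨r, hr, rfl⟩
    · exact isDyadic_zero
    · exact isDyadic_one
    · exact hS r hr
  · intro p q hpq h
    have h0 := h 0 (by simp)
    have h1 := h 1 (by simp)
    rcases le_or_gt q 0 with hq | hq
    · exact ⟨0, 0, isDyadic_zero, fun t ht => by rw [extendF_of_le (ht.2.trans hq)]; simp⟩
    rcases le_or_gt 1 p with hp | hp
    · exact ⟨0, 0, isDyadic_zero, fun t ht => by rw [extendF_of_ge (hp.trans ht.1)]; simp⟩
    have hp0 : 0 ≤ p := by
      by_contra! h'
      exact h0 ⟨h', hq⟩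
    have hq1 : q ≤ 1 := by
      by_contra! h'
      exact h1 ⟨hp, h'⟩
    obtain ⟨k, d, hk⟩ := hpl ⟨p, hp0, hp.le⟩ ⟨q, hq.le, hq1⟩ hpq fun s hs hs' =>
      h s (by simp only [Finset.mem_insert, Finset.mem_image]; exact Or.inr (Or.inr ⟨s, hs, rfl⟩))
        ⟨hs'.1, hs'.2⟩
    refine ⟨k, d, ?_, fun t ht => ?_⟩
    -- `IsDyadicPL` does not ask for dyadic constant terms; dyadicity of `d` follows by evaluating
    -- at a dyadic point, whose image is dyadic.
    · obtain ⟨r, hr, hr'⟩ := exists_isDyadic_between hpq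
      set r' : unitInterval := ⟨r, hp0.trans hr'.1.le, hr'.2.le.trans hq1⟩ with hr''
      have e := hk r' ⟨hr'.1.le, hr'.2.le⟩
      have : d = (f.1 r' : ℝ) - 2 ^ k * r := by
        rw [e]
        ring
      rw [this]
      exact isDyadic_sub (hd r' hr) (hr.zpow_mul k)
    · have htI : t ∈ unitInterval := ⟨hp0.trans ht.1, ht.2.trans hq1⟩
      exact (extendF_coe f ⟨t, htI⟩).trans (hk ⟨t, htI⟩ ht)

theorem exists_extendF_eq {f : Perm ℝ} (hf : f ∈ dyadicPL) (h0 : f 0 = 0) (h1 : f 1 = 1)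
    (hout : ∀ x ∉ unitInterval, f x = x) : ∃ g : thompsonF, extendF g = f := by
  classical
  have hm := strictMono_of_mem hf
  have hm' := strictMono_of_mem (inv_mem hf)
  have h0' : f⁻¹ 0 = 0 := by rw [Perm.inv_eq_iff_eq, h0]
  have h1' : f⁻¹ 1 = 1 := by rw [Perm.inv_eq_iff_eq, h1]
  let G : unitInterval ≃ₜ unitInterval :=
    { toFun := fun x => ⟨f x, h0.symm.trans_le (hm.monotone x.2.1),
        (hm.monotone x.2.2).trans_eq h1⟩
      invFun := fun x => ⟨f⁻¹ x, h0'.symm.trans_le (hm'.monotone x.2.1),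
        (hm'.monotone x.2.2).trans_eq h1'⟩
      left_inv := fun x => Subtype.ext (f.symm_apply_apply x)
      right_inv := fun x => Subtype.ext (f.apply_symm_apply x)
      continuous_toFun := ((continuous_of_mem hf).comp continuous_subtype_val).subtype_mk _
      continuous_invFun :=
        ((continuous_of_mem (inv_mem hf)).comp continuous_subtype_val).subtype_mk _ }
  obtain ⟨S, hS, hSf⟩ := exists_finite_breaks hf zero_le_one
  refine ⟨⟨G, fun x y hxy => hm hxy, S.subtype (· ∈ unitInterval), fun s hs => ?_,
    fun a b hab h => ?_⟩, Equiv.ext fun x => ?_⟩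
  · exact hS s (Finset.mem_subtype.1 hs)
  · obtain ⟨k, d, hk⟩ := hSf a b a.2.1 hab b.2.2 fun s hs hs' =>
      h ⟨s, a.2.1.trans hs'.1.le, hs'.2.le.trans b.2.2⟩ (Finset.mem_subtype.2 hs) hs'
    exact ⟨k, d, fun t ht => hk t ht⟩
  · by_cases hx : x ∈ unitInterval
    · exact extendF_coe _ ⟨x, hx⟩
    · rw [extendF_of_notMem _ hx, hout x hx]

theorem range_extendF_stabilizer {U : Set ℝ} (hU : U ⊆ Ioo 0 1) :
    (extendF.comp (thompsonStabilizer U).subtype).range = fixingPL (Ioo 0 1 \ U) := by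
  apply le_antisymm
  · rintro _ ⟨f, rfl⟩
    refine ⟨extendF_mem_dyadicPL _, fun x hx => ?_⟩
    change extendF f.1 x = x
    by_cases hxU : x ∈ U
    · have hxI : x ∈ unitInterval := Ioo_subset_Icc_self (hU hxU)
      exact (extendF_coe f.1 ⟨x, hxI⟩).trans (congrArg Subtype.val (f.2 ⟨x, hxI⟩ hxU))
    · have : x ∉ Ioo (0 : ℝ) 1 := fun h => hx ⟨h, hxU⟩
      rcases le_or_gt x 0 with h | h
      · exact extendF_of_le h
      · exact extendF_of_ge (not_lt.1 fun h' => this ⟨h, h'⟩)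
  · rintro f ⟨hf, hfV⟩
    obtain ⟨g, rfl⟩ := exists_extendF_eq hf (hfV 0 (by simp)) (hfV 1 (by simp))
      fun x hx => hfV x fun h => hx (Ioo_subset_Icc_self h.1)
    refine ⟨⟨g, fun x hx => Subtype.ext ?_⟩, rfl⟩
    rw [← extendF_coe]
    exact hfV x fun h => h.2 hx

theorem range_extendF : extendF.range = fixingPL (Ioo 0 1) := by
  have := range_extendF_stabilizer (empty_subset (Ioo (0 : ℝ) 1))
  rw [sdiff_empty] at this
  rw [← this]
  apply le_antisymm
  · rintro _ ⟨f, rfl⟩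
    exact ⟨⟨f, fun _ h => absurd h (notMem_empty _)⟩, rfl⟩
  · rintro _ ⟨f, rfl⟩
    exact ⟨f.1, rfl⟩

/-! ### Derived subgroups of stabilizers and the number of factors -/

/-- The intervals are those between consecutive elements of `U ∪ {0, 1}`, listed in increasing
order. -/
theorem exists_gaps {U : Finset ℝ} (hU : (U : Set ℝ) ⊆ Ioo 0 1) :
    ∃ a b : Fin (U.card + 1) → ℝ, (∀ i, a i < b i) ∧
      (Pairwise fun i j => Disjoint (Ioo (a i) (b i)) (Ioo (a j) (b j))) ∧
      (∀ i j, a i ∉ Ioo (a j) (b j)) ∧ (∀ i j, b i ∉ Ioo (a j) (b j)) ∧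
      ⋃ i, Ioo (a i) (b i) = Ioo 0 1 \ U := by
  classical
  have h1 : (1 : ℝ) ∉ U := fun h => (hU h).2.false
  have h0 : (0 : ℝ) ∉ insert 1 U := fun h => by
    rcases Finset.mem_insert.1 h with h | h
    · exact zero_ne_one h
    · exact (hU h).1.false
  have hcard : (insert 0 (insert 1 U)).card = U.card + 1 + 1 := by
    rw [Finset.card_insert_of_notMem h0, Finset.card_insert_of_notMem h1]
  set W := insert 0 (insert 1 U) with hW
  set w := W.orderEmbOfFin hcard with hw
  have hwW : ∀ x, x ∈ W ↔ ∃ k, w k = x := fun x => by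
    have := Set.ext_iff.1 (W.range_orderEmbOfFin hcard) x
    exact this.symm
  have hW01 : ∀ x ∈ W, 0 ≤ x ∧ x ≤ 1 := by
    intro x hx
    rcases Finset.mem_insert.1 hx with rfl | hx
    · simp
    rcases Finset.mem_insert.1 hx with rfl | hx
    · simp
    exact ⟨(hU hx).1.le, (hU hx).2.le⟩
  have hgap : ∀ k i, w k ∉ Ioo (w (Fin.castSucc i)) (w i.succ) := by
    rintro k i ⟨h, h'⟩
    rw [w.lt_iff_lt] at h h'
    simp only [Fin.lt_def, Fin.val_castSucc, Fin.val_succ] at h h'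
    omega
  refine ⟨fun i => w i.castSucc, fun i => w i.succ, fun i => w.strictMono Fin.castSucc_lt_succ,
    ?_, fun i => hgap _, fun i => hgap _, Subset.antisymm ?_ ?_⟩
  · have key : ∀ i j : Fin (U.card + 1), i < j → Disjoint (Ioo (w i.castSucc) (w i.succ))
        (Ioo (w j.castSucc) (w j.succ)) := by
      intro i j hij
      have : w i.succ ≤ w j.castSucc := w.monotone (Fin.succ_le_castSucc_iff.2 hij)
      exact disjoint_left.2 fun x hx hx' => (hx.2.trans_le this).not_gt hx'.1
    intro i j hij
    rcases hij.lt_or_gt with h | h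
    · exact key i j h
    · exact (key j i h).symm
  · refine iUnion_subset fun i x hx => ⟨⟨?_, ?_⟩, fun hxU => ?_⟩
    · exact (hW01 _ ((hwW _).2 ⟨_, rfl⟩)).1.trans_lt hx.1
    · exact hx.2.trans_le (hW01 _ ((hwW _).2 ⟨_, rfl⟩)).2
    · obtain ⟨k, rfl⟩ := (hwW x).1 (Finset.mem_insert_of_mem (Finset.mem_insert_of_mem hxU))
      exact hgap k i hx
  · rintro x ⟨⟨hx0, hx1⟩, hxU⟩
    obtain ⟨k0, hk0⟩ := (hwW 0).1 (Finset.mem_insert_self _ _)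
    obtain ⟨k1, hk1⟩ := (hwW 1).1 (Finset.mem_insert_of_mem (Finset.mem_insert_self _ _))
    obtain ⟨k, hk, hmax⟩ := (Finset.univ.filter fun k => w k < x).exists_max_image id
      ⟨k0, by simpa [hk0] using hx0⟩
    simp only [Finset.mem_filter, Finset.mem_univ, true_and, id] at hk hmax
    have hkl : k ≠ Fin.last _ := by
      rintro rfl
      have : w k1 ≤ w (Fin.last _) := w.monotone (Fin.le_last _)
      linarith
    obtain ⟨i, rfl⟩ := Fin.exists_castSucc_eq.2 hkl
    refine mem_iUnion.2 ⟨i, hk, ?_⟩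
    by_contra! h
    rcases h.eq_or_lt with h | h
    · have hxW : x ∈ W := (hwW x).2 ⟨_, h⟩
      rcases Finset.mem_insert.1 hxW with h | h
      · exact hx0.ne' h
      rcases Finset.mem_insert.1 h with h | h
      · exact hx1.ne h
      · exact hxU h
    · exact absurd (hmax _ h) (not_le.2 Fin.castSucc_lt_succ)

/-- Commuting germs put the derived subgroup inside `germTrivialPL`; conversely that group is
perfect and contained in `fixingPL`, so it consists of products of commutators there. -/
theorem commutator_mulEquiv_pi {G : Type*} [Group G] {j : G →* Perm ℝ}
    (hj : Function.Injective j) {U : Finset ℝ} (hU : (U : Set ℝ) ⊆ Ioo 0 1)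
    (hr : j.range = fixingPL (Ioo 0 1 \ U)) :
    Nonempty (commutator G ≃* (Fin (U.card + 1) → compactPL)) := by
  obtain ⟨a, b, hab, hdisj, ha, hb, hV⟩ := exists_gaps hU
  obtain ⟨e⟩ := germTrivialPL_equiv hab hdisj ha hb
  rw [hV] at e
  have hperf := commutator_eq_top_of_mulEquiv e (commutator_pi_eq_top commutator_compactPL)
  have hcomm : (commutator G).map j = germTrivialPL (Ioo 0 1 \ U) := by
    rw [map_commutator_eq, hr]
    refine le_antisymm (commutator_fixingPL_le _) ?_
    rw [commutator_le_of_perfect hperf]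
    exact Subgroup.commutator_mono (germTrivialPL_le_fixingPL _) (germTrivialPL_le_fixingPL _)
  exact ⟨((commutator G).equivMapOfInjective j hj).trans
    ((MulEquiv.subgroupCongr hcomm).trans e.symm)⟩

theorem commutator_mulEquiv {G H : Type*} [Group G] [Group H] (e : G ≃* H) :
    Nonempty (commutator G ≃* commutator H) := by
  have h : (commutator G).map e.toMonoidHom = commutator H := by
    rw [map_commutator_eq, MonoidHom.range_eq_top.2 e.surjective, commutator_def]
  exact ⟨((commutator G).equivMapOfInjective e.toMonoidHom e.injective).trans
    (MulEquiv.subgroupCongr h)⟩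

/-- In a product of copies of a perfect simple group the number of factors is determined by the
group. -/
theorem card_le_of_pi_mulEquiv {S : Type*} [Group S] [IsSimpleGroup S] (hS : commutator S = ⊤)
    {ι κ : Type*} [Fintype ι] [Fintype κ] (e : (ι → S) ≃* (κ → S)) :
    Fintype.card ι ≤ Fintype.card κ := by
  classical
  obtain ⟨s, hs⟩ := exists_ne (1 : S)
  have hex : ∀ i, ∃ j, e (Pi.mulSingle i s) j ≠ 1 := by
    intro i
    by_contra! h
    have : e (Pi.mulSingle i s) = 1 := funext h
    rw [map_eq_one_iff e e.injective, Pi.mulSingle_eq_one_iff] at this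
    exact hs this
  choose J hJ using hex
  refine Fintype.card_le_of_injective J fun i i' hii' => ?_
  by_contra hne
  let p : ι → S →* S := fun k =>
    (Pi.evalMonoidHom (fun _ => S) (J i)).comp (e.toMonoidHom.comp (MonoidHom.mulSingle (fun _ => S) k))
  have hp : ∀ k x, p k x = e (Pi.mulSingle k x) (J i) := fun _ _ => rfl
  -- Any `y` in the target factor is the coordinate of some `e z`, and conjugation by `z` preserves
  -- the `k`-th factor; hence the image is normal and simplicity applies.
  have htop : ∀ k, p k s ≠ 1 → (p k).range = ⊤ := by
    intro k hk
    have hn : (p k).range.Normal := by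
      refine ⟨?_⟩
      rintro _ ⟨x, rfl⟩ y
      obtain ⟨z, hz⟩ := e.surjective fun _ => y
      refine ⟨z k * x * (z k)⁻¹, ?_⟩
      have h1 : Pi.mulSingle k (z k * x * (z k)⁻¹) = z * Pi.mulSingle k x * z⁻¹ := by
        ext l
        rcases eq_or_ne l k with rfl | h
        · simp
        · simp [h]
      rw [hp, hp, h1, map_mul, map_mul, map_inv, hz]
      rfl
    exact hn.eq_bot_or_eq_top.resolve_left fun h =>
      hk ((Subgroup.eq_bot_iff_forall _).1 h _ ⟨s, rfl⟩)
  have hi := htop i (hJ i)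
  have hi' := htop i' (by rw [hp, hii']; exact hJ i')
  -- Two distinct factors commute, yet both map onto the same copy of `S`; this would make `S`
  -- abelian.
  have hcomm : ∀ x y : S, x * y = y * x := by
    intro x y
    obtain ⟨x, rfl⟩ : x ∈ (p i).range := hi ▸ Subgroup.mem_top x
    obtain ⟨y, rfl⟩ : y ∈ (p i').range := hi' ▸ Subgroup.mem_top y
    have := (Pi.mulSingle_commute hne x y).map e
    exact congrFun this (J i)
  have hbot : commutator S = ⊥ := by
    rw [commutator_def, Subgroup.commutator_eq_bot_iff_le_centralizer]
    intro x _
    rw [Subgroup.mem_centralizer_iff]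
    exact fun y _ => hcomm y x
  exact bot_ne_top (hbot.symm.trans hS)

end DyadicPL

theorem corollaryc :
    IsSimpleGroup (commutator thompsonF) ∧
    (∀ U : Finset ℝ, (U : Set ℝ) ⊆ Set.Ioo 0 1 →
      Nonempty (commutator (thompsonStabilizer (U : Set ℝ)) ≃*
        (Fin (U.card + 1) → commutator thompsonF))) ∧
    (∀ U V : Finset ℝ, (U : Set ℝ) ⊆ Set.Ioo 0 1 → (V : Set ℝ) ⊆ Set.Ioo 0 1 →
      U.card ≠ V.card →
      IsEmpty (thompsonStabilizer (U : Set ℝ) ≃* thompsonStabilizer (V : Set ℝ))) := by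
  -- The empty set leaves a single gap, hence a single factor.
  have hF : Nonempty (commutator thompsonF ≃* DyadicPL.compactPL) := by
    obtain ⟨e⟩ := DyadicPL.commutator_mulEquiv_pi DyadicPL.extendF_injective (U := ∅) (by simp)
      (by simpa using DyadicPL.range_extendF)
    exact ⟨e.trans (MulEquiv.funUnique (Fin 1) DyadicPL.compactPL)⟩
  obtain ⟨e⟩ := hF
  have hU : ∀ U : Finset ℝ, (U : Set ℝ) ⊆ Set.Ioo 0 1 →
      Nonempty (commutator (thompsonStabilizer (U : Set ℝ)) ≃*
        (Fin (U.card + 1) → DyadicPL.compactPL)) := fun U hU =>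
    DyadicPL.commutator_mulEquiv_pi
      (j := DyadicPL.extendF.comp (thompsonStabilizer (U : Set ℝ)).subtype)
      (DyadicPL.extendF_injective.comp Subtype.val_injective) hU
      (DyadicPL.range_extendF_stabilizer hU)
  have hsimple := DyadicPL.isSimpleGroup_compactPL
  refine ⟨e.isSimpleGroup, fun U h => ?_, fun U V hU' hV' hne => ⟨fun f => hne ?_⟩⟩
  · obtain ⟨f⟩ := hU U h
    exact ⟨f.trans (MulEquiv.piCongrRight fun _ => e.symm)⟩
  · obtain ⟨p⟩ := hU U hU'
    obtain ⟨q⟩ := hU V hV'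
    obtain ⟨r⟩ := DyadicPL.commutator_mulEquiv f
    have g := p.symm.trans (r.trans q)
    have h1 := DyadicPL.card_le_of_pi_mulEquiv DyadicPL.commutator_compactPL g
    have h2 := DyadicPL.card_le_of_pi_mulEquiv DyadicPL.commutator_compactPL g.symm
    simp only [Fintype.card_fin] at h1 h2
    omega
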